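/- Let $\mathcal X_1,\mathcal X_2,\mathcal S,\mathcal Y_2,\mathcal Y_3$ be finite sets with $\mathcal X_1,\mathcal X_2$ non-empty, let $Q_S$ be a probability distribution on $\mathcal S$, and let $W_{Y_2,Y_3|X_1,X_2,S}$ be a family of conditional probability distributions from $\mathcal X_1\times\mathcal X_2\times\mathcal S$ to $\mathcal Y_2\times\mathcal Y_3$. Consider the state-dependent discrete memoryless relay channel with informed relay: the states $S^n=(S_1,\dots,S_n)$ are i.i.d. with law $Q_S$ and are known non-causally to the relay only. A code of length $n$ with $M$ messages consists of a source encoder $\{1,\dots,M\}\to\mathcal X_1^n$, relay functions $\phi_i:\mathcal S^n\times\mathcal Y_2^{i-1}\to\mathcal X_2$ with $X_{2,i}=\phi_i(S^n,Y_{2,1},\dots,Y_{2,i-1})$ for $1\le i\le n$, and a decoder $\mathcal Y_3^n\to\{1,\dots,M\}$; at time $i$ the pair $(Y_{2,i},Y_{3,i})$ is generated by the memoryless channel $W(\cdot\,|X_{1,i},X_{2,i},S_i)$. A rate $R$ is achievable if for every $\varepsilon>0$ and all sufficiently large $n$ there is a code of length $n$ with $M\ge e^{nR}$ messages whose error probability,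 averaged over a uniformly distributed message, is at most $\varepsilon$. The capacity $C$ is the supremum of the achievable rates (logarithms are natural; rates are in nats per channel use). Then the maximum $$R^{\mathrm{in}}=\max\ \min\Big\{I(X_1;Y_2|S,U_1),\ \ I(X_1,U_1,U_2;Y_3)-I(U_2;S|U_1)\Big\}$$ exists and $C\ge R^{\mathrm{in}}$, where the maximization is over all joint distributions of the form $$P_{S,U_1,U_2,X_1,X_2,Y_2,Y_3}=Q_S\,P_{U_1}\,P_{X_1|U_1}\,P_{U_2|U_1,S}\,P_{X_2|U_1,U_2,S}\,W_{Y_2,Y_3|X_1,X_2,S}$$ in which the auxiliary random variables $U_1,U_2$ take values in finite alphabets with $$|\mathcal U_1|\le|\mathcal S||\mathcal X_1||\mathcal X_2|+1,\qquad |\mathcal U_2|\le\big(|\mathcal S||\mathcal X_1||\mathcal X_2|+1\big)|\mathcal S||\mathcal X_1||\mathcal X_2|.$$ -/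

import Mathlib

/-! Finite probability mass functions are elements of `stdSimplex ℝ α`.  All logarithms are
natural, so entropies, mutual informations and rates are measured in nats. -/

namespace InformedRelay

section Information

variable {Ω α β γ : Type*} [Fintype Ω] [Fintype α] [Fintype β] [Fintype γ]

open scoped Classical in
/-- The probability mass function of the random variable `A` on the finite probability space
`Ω` with probability mass function `p`. -/
noncomputable def law (p : Ω → ℝ) (A : Ω → α) (a : α) : ℝ :=
  ∑ ω, if A ω = a then p ω else 0

/-- Shannon entropy `H(A) = -∑ₐ P(a) log P(a)`. -/
noncomputable def entropy (p : Ω → ℝ) (A : Ω → α) : ℝ :=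
  ∑ a, Real.negMulLog (law p A a)

/-- Conditional entropy `H(A|B) = H(A,B) - H(B)`. -/
noncomputable def condEntropy (p : Ω → ℝ) (A : Ω → α) (B : Ω → β) : ℝ :=
  entropy p (fun ω => (A ω, B ω)) - entropy p B

/-- Mutual information `I(A;B) = H(A) - H(A|B)`. -/
noncomputable def mutualInfo (p : Ω → ℝ) (A : Ω → α) (B : Ω → β) : ℝ :=
  entropy p A - condEntropy p A B

/-- Conditional mutual information `I(A;B|C) = H(A|C) - H(A|B,C)`. -/
noncomputable def condMutualInfo (p : Ω → ℝ) (A : Ω → α) (B : Ω → β) (C : Ω → γ) : ℝ :=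
  condEntropy p A C - condEntropy p A (fun ω => (B ω, C ω))

end Information

/-- A state-dependent discrete memoryless relay channel: the state distribution `Q_S` and the
transition probabilities `W(y₂, y₃ | x₁, x₂, s)`. -/
structure Channel (X₁ X₂ S Y₂ Y₃ : Type*) [Fintype X₁] [Fintype X₂] [Fintype S]
    [Fintype Y₂] [Fintype Y₃] where
  Q : S → ℝ
  Q_mem : Q ∈ stdSimplex ℝ S
  W : X₁ → X₂ → S → Y₂ × Y₃ → ℝ
  W_mem : ∀ x₁ x₂ s, W x₁ x₂ s ∈ stdSimplex ℝ (Y₂ × Y₃)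

/-- A block code of length `n` with `M` messages, the state being known non-causally to the
relay only.  The relay input at time `i` is a function of the whole state sequence and of the
relay outputs at the times before `i`. -/
structure Code (X₁ X₂ S Y₂ Y₃ : Type*) (n M : ℕ) where
  source : Fin M → Fin n → X₁
  relay : (i : Fin n) → (Fin n → S) → (Fin (i : ℕ) → Y₂) → X₂
  decode : (Fin n → Y₃) → Fin M

section Capacity

variable {X₁ X₂ S Y₂ Y₃ : Type*} [Fintype X₁] [Fintype X₂] [Fintype S]
  [Fintype Y₂] [Fintype Y₃]

/-- The conditional probability, given that message `w` is sent with the code `c`, of the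
state sequence `s` and the relay and destination outputs `y`: the state is i.i.d. and the
channel is memoryless. -/
noncomputable def Channel.blockProb (ch : Channel X₁ X₂ S Y₂ Y₃) {n M : ℕ}
    (c : Code X₁ X₂ S Y₂ Y₃ n M) (w : Fin M) (s : Fin n → S) (y : Fin n → Y₂ × Y₃) : ℝ :=
  (∏ i, ch.Q (s i)) *
    ∏ i, ch.W (c.source w i) (c.relay i s (fun j => (y (j.castLE i.isLt.le)).1)) (s i) (y i)

/-- Average probability of error, the message being uniformly distributed. -/
noncomputable def Channel.errorProb (ch : Channel X₁ X₂ S Y₂ Y₃) {n M : ℕ}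
    (c : Code X₁ X₂ S Y₂ Y₃ n M) : ℝ :=
  (∑ w : Fin M, ∑ s : Fin n → S, ∑ y : Fin n → Y₂ × Y₃,
    if c.decode (fun i => (y i).2) ≠ w then ch.blockProb c w s y else 0) / M

/-- The rate `R` (in nats per channel use) is achievable: for all large `n` there are codes of
length `n` with at least `exp (n R)` messages and arbitrarily small error probability. -/
def Channel.Achievable (ch : Channel X₁ X₂ S Y₂ Y₃) (R : ℝ) : Prop :=
  ∀ ε : ℝ, 0 < ε → ∃ n₀ : ℕ, ∀ n : ℕ, n₀ ≤ n →
    ∃ (M : ℕ) (c : Code X₁ X₂ S Y₂ Y₃ n M),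
      Real.exp (n * R) ≤ M ∧ ch.errorProb c ≤ ε

/-- The capacity: the supremum, in the extended reals, of the achievable rates. -/
noncomputable def Channel.capacity (ch : Channel X₁ X₂ S Y₂ Y₃) : EReal :=
  ⨆ (R : ℝ) (_ : ch.Achievable R), (R : EReal)

end Capacity

/-- The free factors `P_{U₁}`, `P_{X₁|U₁}`, `P_{U₂|U₁,S}`, `P_{X₂|U₁,U₂,S}` of the joint
distribution, for auxiliary alphabets `U₁` and `U₂`. -/
structure Input (X₁ X₂ S U₁ U₂ : Type*) [Fintype X₁] [Fintype X₂] [Fintype U₁]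
    [Fintype U₂] where
  PU₁ : U₁ → ℝ
  PU₁_mem : PU₁ ∈ stdSimplex ℝ U₁
  PX₁ : U₁ → X₁ → ℝ
  PX₁_mem : ∀ u₁, PX₁ u₁ ∈ stdSimplex ℝ X₁
  PU₂ : U₁ → S → U₂ → ℝ
  PU₂_mem : ∀ u₁ s, PU₂ u₁ s ∈ stdSimplex ℝ U₂
  PX₂ : U₁ → U₂ → S → X₂ → ℝ
  PX₂_mem : ∀ u₁ u₂ s, PX₂ u₁ u₂ s ∈ stdSimplex ℝ X₂

section InnerBound

variable {X₁ X₂ S Y₂ Y₃ U₁ U₂ : Type*} [Fintype X₁] [Fintype X₂] [Fintype S]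
  [Fintype Y₂] [Fintype Y₃] [Fintype U₁] [Fintype U₂]

/-- The joint distribution of `(S, U₁, U₂, X₁, X₂, Y₂, Y₃)`. -/
def Input.joint (P : Input X₁ X₂ S U₁ U₂) (ch : Channel X₁ X₂ S Y₂ Y₃) :
    S × U₁ × U₂ × X₁ × X₂ × Y₂ × Y₃ → ℝ :=
  fun (s, u₁, u₂, x₁, x₂, y₂, y₃) =>
    ch.Q s * P.PU₁ u₁ * P.PX₁ u₁ x₁ * P.PU₂ u₁ s u₂ * P.PX₂ u₁ u₂ s x₂ *
      ch.W x₁ x₂ s (y₂, y₃)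

/-- `min {I(X₁;Y₂|S,U₁), I(X₁,U₁,U₂;Y₃) - I(U₂;S|U₁)}` under the joint distribution. -/
noncomputable def Input.rate (P : Input X₁ X₂ S U₁ U₂) (ch : Channel X₁ X₂ S Y₂ Y₃) : ℝ :=
  min
    (condMutualInfo (P.joint ch) (fun (_, _, _, x₁, _, _, _) => x₁)
      (fun (_, _, _, _, _, y₂, _) => y₂) (fun (s, u₁, _, _, _, _, _) => (s, u₁)))
    (mutualInfo (P.joint ch) (fun (_, u₁, u₂, x₁, _, _, _) => (x₁, u₁, u₂))
        (fun (_, _, _, _, _, _, y₃) => y₃) -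
      condMutualInfo (P.joint ch) (fun (_, _, u₂, _, _, _, _) => u₂)
        (fun (s, _, _, _, _, _, _) => s) (fun (_, u₁, _, _, _, _, _) => u₁))

/-- The values over which the lower bound is maximized: all joint distributions whose auxiliary
alphabets satisfy `|U₁| ≤ |S||X₁||X₂| + 1` and `|U₂| ≤ (|S||X₁||X₂| + 1)|S||X₁||X₂|`. -/
def Channel.innerRates (ch : Channel X₁ X₂ S Y₂ Y₃) : Set ℝ :=
  {r | ∃ k₁ k₂ : ℕ,
    k₁ ≤ Fintype.card S * Fintype.card X₁ * Fintype.card X₂ + 1 ∧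
    k₂ ≤ (Fintype.card S * Fintype.card X₁ * Fintype.card X₂ + 1) *
      (Fintype.card S * Fintype.card X₁ * Fintype.card X₂) ∧
    ∃ P : Input X₁ X₂ S (Fin k₁) (Fin k₂), P.rate ch = r}

end InnerBound

end InformedRelay

/-! The scheme is block Markov coding with backward decoding. In each block the source sends a new
message `w` on top of the previous one `w'`. The relay, which knows `w'` and the states, helps to
resend `w'` and estimates `w`; the destination estimates `w'` once it knows `w`. The main work
concerns one block, seen as a single use of a channel (`BlockCode`).

For a single use (`exists_blockCode`), each `w'` gets a random word: a centre `u₁`, letters `x₁` for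
all `w`, and `J` letters `u₂` drawn from `P_{U₂|U₁}`. No Gelfand–Pinsker encoder searches for a `u₂`
that fits the state. Instead the analysis takes a uniform index `j` and draws the state from its
posterior given `u₁` and the `j`-th letter; letters, state and outputs then follow the joint law. By
`soft_covering` the averaged posterior nearly dominates `Q_S` once `J` exceeds the exponential of
`I(U₂;S|U₁)`. The decoders do not refer to a chosen index, so the relay may send, for each `w'` and
`s`, the letter that minimises the failure probability (`exists_relay_sum_err_le`). Likelihood-ratio
tests reject wrong messages: about `M` competitors at the relay against `I(X₁;Y₂|S,U₁)`, about `M *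
J` at the destination against `I(X₁,U₁,U₂;Y₃)`. These give the two terms of the minimum. For `m`
independent copies, Chebyshev's inequality concentrates the information densities
(`exists_blockCode_pow_le`).

In a chain the relay acts on its own estimates, so the blocks are not independent. Where no block
fails, however, the law agrees with a product law, and total mass one turns this into a union bound
over blocks (`sum_ind_not_le`, `exists_code_of_blockCode`). Long chains make the loss of one block's
message negligible, and padding reaches the other lengths. The maximum exists because the rate is
continuous on a compact set of inputs and there are finitely many pairs of alphabet sizes; the
cardinality bounds play no other role. -/

open Finset

namespace InformedRelay

/-! ### Product distributions, second moments and soft covering -/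

section ProductSums

variable {ι α : Type*} [Fintype ι] [DecidableEq ι] [Fintype α]

open scoped Classical in
/-- The real-valued indicator of a proposition. -/
noncomputable def ind (p : Prop) : ℝ := if p then 1 else 0

theorem ind_of_true {p : Prop} (h : p) : ind p = 1 := by simp [ind, h]

theorem ind_of_false {p : Prop} (h : ¬p) : ind p = 0 := by simp [ind, h]

theorem ind_nonneg (p : Prop) : 0 ≤ ind p := by unfold ind; split_ifs <;> norm_num

theorem ind_le_one (p : Prop) : ind p ≤ 1 := by unfold ind; split_ifs <;> norm_num

theorem ind_mono {p q : Prop} (h : p → q) : ind p ≤ ind q := by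
  by_cases hp : p
  · rw [ind_of_true hp, ind_of_true (h hp)]
  · rw [ind_of_false hp]; exact ind_nonneg q

theorem ind_add_ind_not (p : Prop) : ind p + ind (¬p) = 1 := by
  by_cases hp : p <;> simp [ind, hp]

theorem sum_pi_prod (p : ι → α → ℝ) :
    ∑ f : ι → α, ∏ i, p i (f i) = ∏ i, ∑ x, p i x := by
  classical
  rw [Finset.prod_univ_sum, Fintype.piFinset_univ]

/-- Expectation of a product of two functions of distinct coordinates. -/
theorem sum_pi_mul_mul (p : ι → α → ℝ) (hp : ∀ i, ∑ x, p i x = 1) {a b : ι} (hab : a ≠ b)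
    (g k : α → ℝ) :
    ∑ f : ι → α, (∏ i, p i (f i)) * (g (f a) * k (f b)) =
      (∑ x, p a x * g x) * ∑ x, p b x * k x := by
  classical
  have h := sum_pi_prod
    (fun i x => p i x * ((if i = a then g x else 1) * (if i = b then k x else 1)))
  simp only [Finset.prod_mul_distrib, Finset.prod_ite_eq', Finset.mem_univ, if_true] at h
  rw [h]
  rw [← Finset.mul_prod_erase univ _ (Finset.mem_univ a),
    ← Finset.mul_prod_erase (univ.erase a) _ (Finset.mem_erase.2 ⟨hab.symm, Finset.mem_univ b⟩),
    Finset.prod_eq_one]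
  · simp [hab, hab.symm]
  · intro i hi
    simp only [Finset.mem_erase, Finset.mem_univ, and_true] at hi
    simp [hi.1, hi.2, hp]

/-- The marginal of a product distribution at one coordinate. -/
theorem sum_pi_eval (p : ι → α → ℝ) (hp : ∀ i, ∑ x, p i x = 1) (a : ι) (g : α → ℝ) :
    ∑ f : ι → α, (∏ i, p i (f i)) * g (f a) = ∑ x, p a x * g x := by
  classical
  have h := sum_pi_prod (fun i x => p i x * (if i = a then g x else 1))
  simp only [Finset.prod_mul_distrib, Finset.prod_ite_eq', Finset.mem_univ, if_true] at h
  rw [h, Finset.prod_eq_single a]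
  · simp
  · intro i _ hi
    simp [hi, hp]
  · simp

/-- The marginal of a product distribution at two distinct coordinates. -/
theorem sum_pi_eval_two (p : ι → α → ℝ) (hp : ∀ i, ∑ x, p i x = 1) {a b : ι} (hab : a ≠ b)
    (g : α → α → ℝ) :
    ∑ f : ι → α, (∏ i, p i (f i)) * g (f a) (f b) =
      ∑ x, ∑ y, p a x * p b y * g x y := by
  classical
  have h1 : ∀ f : ι → α, (∏ i, p i (f i)) * g (f a) (f b) =
      ∑ y, (∏ i, p i (f i)) * (g (f a) y * (if f b = y then 1 else 0)) := by
    intro f; simp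
  simp only [h1]
  rw [Finset.sum_comm]
  refine (Finset.sum_congr rfl fun y _ => ?_).trans Finset.sum_comm
  rw [sum_pi_mul_mul p hp hab (fun x => g x y) (fun x => if x = y then 1 else 0), Finset.sum_mul]
  refine Finset.sum_congr rfl fun x _ => ?_
  simp; ring

theorem pi_mem_stdSimplex (p : ι → α → ℝ) (hp : ∀ i, p i ∈ stdSimplex ℝ α) :
    (fun f : ι → α => ∏ i, p i (f i)) ∈ stdSimplex ℝ (ι → α) := by
  refine ⟨fun f => Finset.prod_nonneg fun i _ => (hp i).1 _, ?_⟩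
  rw [sum_pi_prod, Finset.prod_eq_one fun i _ => (hp i).2]

/-- The second moment of a sum of independent identically distributed centred variables. -/
theorem sum_pi_sq (p : α → ℝ) (hp : ∑ x, p x = 1) (h : α → ℝ) (hh : ∑ x, p x * h x = 0) :
    ∑ f : ι → α, (∏ i, p (f i)) * (∑ i, h (f i)) ^ 2 =
      Fintype.card ι * ∑ x, p x * h x ^ 2 := by
  classical
  have h1 : ∀ f : ι → α, (∏ i, p (f i)) * (∑ i, h (f i)) ^ 2 =
      ∑ i, ∑ j, (∏ i, p (f i)) * (h (f i) * h (f j)) := by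
    intro f
    rw [sq, Finset.sum_mul_sum, Finset.mul_sum]
    exact Finset.sum_congr rfl fun i _ => Finset.mul_sum _ _ _
  simp only [h1]
  rw [Finset.sum_comm]
  have h2 : ∀ i : ι, ∑ f : ι → α, ∑ j, (∏ i, p (f i)) * (h (f i) * h (f j)) =
      ∑ x, p x * h x ^ 2 := by
    intro i
    rw [Finset.sum_comm, Finset.sum_eq_single i]
    · rw [sum_pi_eval (fun _ => p) (fun _ => hp) i (fun x => h x * h x)]
      simp only [sq]
    · intro j _ hj
      rw [sum_pi_mul_mul (fun _ => p) (fun _ => hp) hj.symm, hh, zero_mul]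
    · simp
  simp [h2]

/-- Chebyshev's inequality for a sum of independent identically distributed centred variables. -/
theorem sum_pi_ind_le (p : α → ℝ) (hp : p ∈ stdSimplex ℝ α) (h : α → ℝ)
    (hh : ∑ x, p x * h x = 0) {t : ℝ} (ht : 0 < t) :
    ∑ f : ι → α, (∏ i, p (f i)) * ind (t ≤ |∑ i, h (f i)|) ≤
      Fintype.card ι * (∑ x, p x * h x ^ 2) / t ^ 2 := by
  rw [← sum_pi_sq p hp.2 h hh, Finset.sum_div]
  refine Finset.sum_le_sum fun f _ => ?_
  rw [mul_div_assoc]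
  refine mul_le_mul_of_nonneg_left ?_ (Finset.prod_nonneg fun i _ => hp.1 _)
  by_cases hf : t ≤ |∑ i, h (f i)|
  · rw [ind_of_true hf, le_div_iff₀ (by positivity), one_mul, ← sq_abs (∑ i, h (f i))]
    gcongr
  · rw [ind_of_false hf]; positivity

/-- The averaging argument of random coding. It fixes the code book, and later the two known
messages at the ends of a chain. -/
theorem exists_le_of_sum_mul_le {p : α → ℝ} (hp : p ∈ stdSimplex ℝ α) {F : α → ℝ} {c : ℝ}
    (h : ∑ x, p x * F x ≤ c) : ∃ x, F x ≤ c := by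
  by_contra! hF
  have h1 : ∑ x, p x * c < ∑ x, p x * F x := by
    refine Finset.sum_lt_sum (fun x _ => mul_le_mul_of_nonneg_left (hF x).le (hp.1 x)) ?_
    obtain ⟨x, hx⟩ : ∃ x, p x ≠ 0 := by
      by_contra! h0
      have := hp.2
      simp [h0] at this
    exact ⟨x, Finset.mem_univ x,
      mul_lt_mul_of_pos_left (hF x) (lt_of_le_of_ne (hp.1 x) hx.symm)⟩
  rw [← Finset.sum_mul, hp.2, one_mul] at h1
  linarith

/-- Soft covering: the average of `J` independent samples of a likelihood with mean `Q`
falls below `Q` by little. -/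
theorem soft_covering {J : ℕ} (hJ : 0 < J) {q : α → ℝ} (hq : q ∈ stdSimplex ℝ α)
    {l : α → ℝ} (hl : ∀ u, 0 ≤ l u) {T : α → Prop} {Q κ δ : ℝ} (hQ : 0 ≤ Q) (hκ : 0 ≤ κ)
    (hδ : 0 < δ) (hmean : ∑ u, q u * l u = Q) (hT : ∀ u, T u → l u ≤ κ * Q) :
    ∑ f : Fin J → α, (∏ j, q (f j)) * max 0 (Q - (∑ j, l (f j)) / J) ≤
      ∑ u, q u * l u * ind (¬T u) + Q * (δ + κ / (δ * J)) := by
  have hJ' : (0 : ℝ) < J := by exact_mod_cast hJ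
  have hF : ∀ f : Fin J → α, 0 ≤ ∏ j, q (f j) := fun f => Finset.prod_nonneg fun j _ => hq.1 _
  -- The case of mean zero is separate because the main estimate divides by `δ * Q`.
  rcases hQ.eq_or_lt with rfl | hQ
  · rw [Finset.sum_eq_zero]
    · rw [zero_mul, add_zero]
      exact Finset.sum_nonneg fun u _ =>
        mul_nonneg (mul_nonneg (hq.1 u) (hl u)) (ind_nonneg _)
    · intro f _
      rw [max_eq_left, mul_zero]
      have : 0 ≤ (∑ j, l (f j)) / J := div_nonneg (Finset.sum_nonneg fun j _ => hl _) hJ'.le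
      linarith
  -- Truncation to `T`: the lost mean `Q - μ` is the first term of the bound, and the truncated
  -- likelihood has variance at most `κ * Q ^ 2`.
  set l' : α → ℝ := fun u => l u * ind (T u) with hl'
  set μ : ℝ := ∑ u, q u * l' u with hμ
  have hl'0 : ∀ u, 0 ≤ l' u := fun u => mul_nonneg (hl u) (ind_nonneg _)
  have hl'l : ∀ u, l' u ≤ l u := fun u => mul_le_of_le_one_right (hl u) (ind_le_one _)
  have hl'κ : ∀ u, l' u ≤ κ * Q := by
    intro u
    by_cases hu : T u
    · exact (hl'l u).trans (hT u hu)
    · simp only [hl', ind_of_false hu, mul_zero]; positivity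
  have hμQ : Q - μ = ∑ u, q u * l u * ind (¬T u) := by
    rw [← hmean, hμ, ← Finset.sum_sub_distrib]
    refine Finset.sum_congr rfl fun u _ => ?_
    have := ind_add_ind_not (T u)
    simp only [hl']
    rw [← eq_sub_iff_add_eq'] at this
    rw [this]; ring
  have hμ0 : 0 ≤ Q - μ := by
    rw [hμQ]
    exact Finset.sum_nonneg fun u _ => mul_nonneg (mul_nonneg (hq.1 u) (hl u)) (ind_nonneg _)
  have hcent : ∑ u, q u * (μ - l' u) = 0 := by
    simp only [mul_sub, Finset.sum_sub_distrib, ← Finset.sum_mul, hq.2]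
    rw [one_mul, ← hμ, sub_self]
  have hsq := sum_pi_sq (ι := Fin J) q hq.2 (fun u => μ - l' u) hcent
  rw [Fintype.card_fin] at hsq
  have hvar : ∑ u, q u * (μ - l' u) ^ 2 ≤ κ * Q ^ 2 := by
    have h1 : ∑ u, q u * (μ - l' u) ^ 2 = ∑ u, q u * l' u ^ 2 - μ ^ 2 := by
      have : ∀ u, q u * (μ - l' u) ^ 2 = q u * l' u ^ 2 - 2 * μ * (q u * l' u) + q u * μ ^ 2 := by
        intro u; ring
      simp only [this, Finset.sum_add_distrib, Finset.sum_sub_distrib, ← Finset.mul_sum,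
        ← Finset.sum_mul, hq.2]
      rw [← hμ]; ring
    have h2 : ∑ u, q u * l' u ^ 2 ≤ ∑ u, κ * Q * (q u * l' u) := by
      refine Finset.sum_le_sum fun u _ => ?_
      have := mul_le_mul_of_nonneg_left (hl'κ u) (mul_nonneg (hq.1 u) (hl'0 u))
      nlinarith
    rw [← Finset.mul_sum, ← hμ] at h2
    have h3 : κ * Q * μ ≤ κ * Q * Q := mul_le_mul_of_nonneg_left (by linarith) (by positivity)
    nlinarith [sq_nonneg μ]
  have hpt : ∀ f : Fin J → α, max 0 (Q - (∑ j, l (f j)) / J) ≤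
      (Q - μ) + δ * Q + (∑ j, (μ - l' (f j))) ^ 2 / (J ^ 2 * (δ * Q)) := by
    intro f
    refine max_le (by positivity) ?_
    set t := (∑ j, (μ - l' (f j))) / J with ht
    have h1 : Q - (∑ j, l (f j)) / J ≤ (Q - μ) + t := by
      have : t = μ - (∑ j, l' (f j)) / J := by
        rw [ht, Finset.sum_sub_distrib]
        simp; field_simp
      rw [this]
      have : (∑ j, l' (f j)) / J ≤ (∑ j, l (f j)) / J := by
        gcongr; exact hl'l _
      linarith
    have h2 : (∑ j, (μ - l' (f j))) ^ 2 / (J ^ 2 * (δ * Q)) = t ^ 2 / (δ * Q) := by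
      rw [ht, div_pow, div_div]
    -- A deviation is either at most `δ * Q` or paid for by its square, so the second moment
    -- suffices.
    have h3 : t ≤ δ * Q + t ^ 2 / (δ * Q) := by
      have hd : 0 < δ * Q := by positivity
      rw [← sub_le_iff_le_add', le_div_iff₀ hd]
      nlinarith [sq_nonneg (t - δ * Q), sq_nonneg t, sq_nonneg (δ * Q)]
    rw [h2]; linarith
  calc ∑ f : Fin J → α, (∏ j, q (f j)) * max 0 (Q - (∑ j, l (f j)) / J)
      ≤ ∑ f : Fin J → α, (∏ j, q (f j)) *
          ((Q - μ) + δ * Q + (∑ j, (μ - l' (f j))) ^ 2 / (J ^ 2 * (δ * Q))) :=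
        Finset.sum_le_sum fun f _ => mul_le_mul_of_nonneg_left (hpt f) (hF f)
    _ = (Q - μ) + δ * Q + J * (∑ u, q u * (μ - l' u) ^ 2) / (J ^ 2 * (δ * Q)) := by
        rw [← hsq]
        simp only [mul_add, Finset.sum_add_distrib, ← Finset.sum_mul, Finset.sum_div, mul_div_assoc]
        rw [(pi_mem_stdSimplex (fun _ : Fin J => q) fun _ => hq).2]
        ring
    _ ≤ (Q - μ) + δ * Q + J * (κ * Q ^ 2) / (J ^ 2 * (δ * Q)) := by gcongr
    _ = _ := by rw [hμQ]; field_simp; ring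

end ProductSums

/-! ### One-shot block codes and random words -/

/-- A code for one use of the channel in a chain of uses: the use that carries the new message
`w` and resends the previous message `w'`.  The relay sends a function of `w'` and of the state
and estimates `w`; the destination estimates `w'` once it knows `w`. -/
structure BlockCode (X₁ X₂ S Y₂ Y₃ : Type*) (M : ℕ) where
  source : Fin M → Fin M → X₁
  relay : Fin M → S → X₂
  relayDecode : Fin M → S → Y₂ → Fin M
  decode : Fin M → Y₃ → Fin M

section OneShot

variable {X₁ X₂ S Y₂ Y₃ U₁ U₂ : Type*} [Fintype X₁] [Fintype X₂] [Fintype S]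
  [Fintype Y₂] [Fintype Y₃] [Fintype U₁] [Fintype U₂]

/-- One of the two estimates is wrong. -/
def BlockCode.Fails {M : ℕ} (c : BlockCode X₁ X₂ S Y₂ Y₃ M) (w prev : Fin M) (s : S)
    (y : Y₂ × Y₃) : Prop :=
  c.relayDecode prev s y.1 ≠ w ∨ c.decode w y.2 ≠ prev

/-- The error probability of a block code for the new message `w` and the previous one `w'`. -/
noncomputable def BlockCode.err {M : ℕ} (c : BlockCode X₁ X₂ S Y₂ Y₃ M)
    (ch : Channel X₁ X₂ S Y₂ Y₃) (w w' : Fin M) : ℝ :=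
  ∑ s, ch.Q s * ∑ y, ch.W (c.source w w') (c.relay w' s) s y * ind (c.Fails w w' s y)

variable (P : Input X₁ X₂ S U₁ U₂) (ch : Channel X₁ X₂ S Y₂ Y₃)

/-- The conditional distribution `P_{U₂|U₁}`. -/
noncomputable def Input.aux (u₁ : U₁) (u₂ : U₂) : ℝ := ∑ s, ch.Q s * P.PU₂ u₁ s u₂

/-- The conditional distribution `P_{S|U₁,U₂}`. -/
noncomputable def Input.posterior (u₁ : U₁) (u₂ : U₂) (s : S) : ℝ :=
  ch.Q s * P.PU₂ u₁ s u₂ / P.aux ch u₁ u₂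

theorem Input.aux_mem (u₁ : U₁) : P.aux ch u₁ ∈ stdSimplex ℝ U₂ := by
  refine ⟨fun u₂ => Finset.sum_nonneg fun s _ =>
    mul_nonneg (ch.Q_mem.1 s) ((P.PU₂_mem u₁ s).1 u₂), ?_⟩
  unfold Input.aux
  rw [Finset.sum_comm]
  simp only [← Finset.mul_sum, (P.PU₂_mem u₁ _).2, mul_one, ch.Q_mem.2]

theorem Input.posterior_nonneg (u₁ : U₁) (u₂ : U₂) (s : S) : 0 ≤ P.posterior ch u₁ u₂ s :=
  div_nonneg (mul_nonneg (ch.Q_mem.1 s) ((P.PU₂_mem u₁ s).1 u₂)) ((P.aux_mem ch u₁).1 u₂)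

/-- Bayes' rule. It survives `P.aux ch u₁ u₂ = 0`, because the right side is then a term of a
vanishing sum of nonnegative terms. -/
theorem Input.aux_mul_posterior (u₁ : U₁) (u₂ : U₂) (s : S) :
    P.aux ch u₁ u₂ * P.posterior ch u₁ u₂ s = ch.Q s * P.PU₂ u₁ s u₂ := by
  unfold Input.posterior
  by_cases h : P.aux ch u₁ u₂ = 0
  · have h' := (Finset.sum_eq_zero_iff_of_nonneg fun s _ =>
      mul_nonneg (ch.Q_mem.1 s) ((P.PU₂_mem u₁ s).1 u₂)).1 h s (Finset.mem_univ s)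
    rw [h, h', zero_mul]
  · field_simp

/-- Only an inequality: division by zero makes the posterior vanish at letters `u₂` of probability
zero. -/
theorem Input.sum_posterior_le_one (u₁ : U₁) (u₂ : U₂) : ∑ s, P.posterior ch u₁ u₂ s ≤ 1 := by
  unfold Input.posterior
  rw [← Finset.sum_div]
  exact div_self_le_one _

/-- The conditional distribution of `(S, X₂, Y₂, Y₃)` given `(U₁, X₁, U₂)`. -/
noncomputable def Input.kernel (u₁ : U₁) (x₁ : X₁) (u₂ : U₂) : S × X₂ × Y₂ × Y₃ → ℝ :=
  fun (s, x₂, y₂, y₃) =>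
    P.posterior ch u₁ u₂ s * P.PX₂ u₁ u₂ s x₂ * ch.W x₁ x₂ s (y₂, y₃)

theorem Input.kernel_nonneg (u₁ : U₁) (x₁ : X₁) (u₂ : U₂) (t : S × X₂ × Y₂ × Y₃) :
    0 ≤ P.kernel ch u₁ x₁ u₂ t :=
  mul_nonneg (mul_nonneg (P.posterior_nonneg ch _ _ _) ((P.PX₂_mem _ _ _).1 _))
    ((ch.W_mem _ _ _).1 _)

theorem Input.sum_kernel_le_one (u₁ : U₁) (x₁ : X₁) (u₂ : U₂) :
    ∑ t, P.kernel ch u₁ x₁ u₂ t ≤ 1 := by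
  have h : ∀ x₂ s, ∑ y₂, ∑ y₃, ch.W x₁ x₂ s (y₂, y₃) = 1 := by
    intro x₂ s
    rw [← Fintype.sum_prod_type']
    exact (ch.W_mem x₁ x₂ s).2
  simp only [Input.kernel, Fintype.sum_prod_type, ← Finset.mul_sum, h, mul_one,
    (P.PX₂_mem _ _ _).2]
  exact P.sum_posterior_le_one ch u₁ u₂

/-- The part of a random code book that belongs to one previous message. -/
abbrev Word (U₁ X₁ U₂ : Type*) (M J : ℕ) := U₁ × (Fin M → X₁) × (Fin J → U₂)

/-- The distribution of a random word. -/
noncomputable def Input.wordProb {M J : ℕ} (c : Word U₁ X₁ U₂ M J) : ℝ :=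
  P.PU₁ c.1 * ((∏ w, P.PX₁ c.1 (c.2.1 w)) * ∏ j, P.aux ch c.1 (c.2.2 j))

theorem Input.sum_wordProb_mul {M J : ℕ} (g : Word U₁ X₁ U₂ M J → ℝ) :
    ∑ c, P.wordProb ch c * g c = ∑ u₁, P.PU₁ u₁ * ∑ x : Fin M → X₁, (∏ w, P.PX₁ u₁ (x w)) *
      ∑ u : Fin J → U₂, (∏ j, P.aux ch u₁ (u j)) * g (u₁, x, u) := by
  simp only [Input.wordProb, Fintype.sum_prod_type, Finset.mul_sum, mul_assoc]

theorem Input.wordProb_mem {M J : ℕ} :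
    P.wordProb ch (M := M) (J := J) ∈ stdSimplex ℝ (Word U₁ X₁ U₂ M J) := by
  constructor
  · intro c
    exact mul_nonneg (P.PU₁_mem.1 _) (mul_nonneg
      (Finset.prod_nonneg fun w _ => (P.PX₁_mem _).1 _)
      (Finset.prod_nonneg fun w _ => (P.aux_mem ch _).1 _))
  · have h := P.sum_wordProb_mul ch (M := M) (J := J) (fun _ => 1)
    simp only [mul_one] at h
    rw [h]
    simp only [(pi_mem_stdSimplex (fun _ : Fin J => P.aux ch _) fun _ => P.aux_mem ch _).2,
      (pi_mem_stdSimplex (fun _ : Fin M => P.PX₁ _) fun _ => P.PX₁_mem _).2, mul_one,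
      P.PU₁_mem.2]

theorem Input.sum_wordProb_eval {M J : ℕ} (w : Fin M) (j : Fin J) (g : U₁ → X₁ → U₂ → ℝ) :
    ∑ c : Word U₁ X₁ U₂ M J, P.wordProb ch c * g c.1 (c.2.1 w) (c.2.2 j) =
      ∑ u₁, P.PU₁ u₁ * ∑ x₁, P.PX₁ u₁ x₁ * ∑ u₂, P.aux ch u₁ u₂ * g u₁ x₁ u₂ := by
  rw [P.sum_wordProb_mul ch (fun c => g c.1 (c.2.1 w) (c.2.2 j))]
  refine Finset.sum_congr rfl fun u₁ _ => ?_
  congr 1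
  rw [← sum_pi_eval (fun _ => P.PX₁ u₁) (fun _ => (P.PX₁_mem u₁).2) w
    (fun x₁ => ∑ u₂, P.aux ch u₁ u₂ * g u₁ x₁ u₂)]
  refine Finset.sum_congr rfl fun x _ => ?_
  congr 1
  exact sum_pi_eval (fun _ => P.aux ch u₁) (fun _ => (P.aux_mem ch u₁).2) j
    (fun u₂ => g u₁ (x w) u₂)

/-- Serves the relay's test of a wrong message: one source letter is sent, the other is tested, and
given `u₁` they are independent. -/
theorem Input.sum_wordProb_eval_two {M J : ℕ} {v w : Fin M} (hvw : v ≠ w) (j : Fin J)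
    (g : U₁ → X₁ → X₁ → U₂ → ℝ) :
    ∑ c : Word U₁ X₁ U₂ M J, P.wordProb ch c * g c.1 (c.2.1 v) (c.2.1 w) (c.2.2 j) =
      ∑ u₁, P.PU₁ u₁ * ∑ x, ∑ x', P.PX₁ u₁ x * P.PX₁ u₁ x' *
        ∑ u₂, P.aux ch u₁ u₂ * g u₁ x x' u₂ := by
  rw [P.sum_wordProb_mul ch (fun c => g c.1 (c.2.1 v) (c.2.1 w) (c.2.2 j))]
  refine Finset.sum_congr rfl fun u₁ _ => ?_
  congr 1
  rw [← sum_pi_eval_two (fun _ => P.PX₁ u₁) (fun _ => (P.PX₁_mem u₁).2) hvw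
    (fun x x' => ∑ u₂, P.aux ch u₁ u₂ * g u₁ x x' u₂)]
  refine Finset.sum_congr rfl fun x _ => ?_
  congr 1
  exact sum_pi_eval (fun _ => P.aux ch u₁) (fun _ => (P.aux_mem ch u₁).2) j
    (fun u₂ => g u₁ (x v) (x w) u₂)

/-- Integration against the joint distribution through the kernel. -/
theorem Input.sum_kernel_eq_sum_joint (φ : U₁ → X₁ → U₂ → S × X₂ × Y₂ × Y₃ → ℝ) :
    ∑ u₁, P.PU₁ u₁ * ∑ x₁, P.PX₁ u₁ x₁ * ∑ u₂, P.aux ch u₁ u₂ *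
        ∑ t, P.kernel ch u₁ x₁ u₂ t * φ u₁ x₁ u₂ t =
      ∑ z, P.joint ch z * (fun (s, u₁, u₂, x₁, x₂, y₂, y₃) => φ u₁ x₁ u₂ (s, x₂, y₂, y₃)) z := by
  simp only [Finset.mul_sum]
  simp only [← Fintype.sum_prod_type' (α₁ := U₂), ← Fintype.sum_prod_type' (α₁ := X₁),
    ← Fintype.sum_prod_type' (α₁ := U₁)]
  refine Fintype.sum_equiv
    { toFun := fun (u₁, x₁, u₂, s, x₂, y₂, y₃) => (s, u₁, u₂, x₁, x₂, y₂, y₃)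
      invFun := fun (s, u₁, u₂, x₁, x₂, y₂, y₃) => (u₁, x₁, u₂, s, x₂, y₂, y₃)
      left_inv := fun _ => rfl
      right_inv := fun _ => rfl } _ _ ?_
  rintro ⟨u₁, x₁, u₂, s, x₂, y₂, y₃⟩
  have := P.aux_mul_posterior ch u₁ u₂ s
  simp only [Input.kernel, Input.joint, Equiv.coe_fn_mk]
  linear_combination P.PU₁ u₁ * P.PX₁ u₁ x₁ * P.PX₂ u₁ u₂ s x₂ * ch.W x₁ x₂ s (y₂, y₃) *
    φ u₁ x₁ u₂ (s, x₂, y₂, y₃) * this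

end OneShot

/-! ### Random code books: mean test errors and covering -/

section RandomCoding

variable {X₁ X₂ S Y₂ Y₃ U₁ U₂ : Type*} [Fintype X₁] [Fintype X₂] [Fintype S]
  [Fintype Y₂] [Fintype Y₃] [Fintype U₁] [Fintype U₂]

variable (P : Input X₁ X₂ S U₁ U₂) (ch : Channel X₁ X₂ S Y₂ Y₃) {M J : ℕ}

/-- The distribution of a random code book: independent words. -/
noncomputable def Input.bookProb (b : Fin M → Word U₁ X₁ U₂ M J) : ℝ :=
  ∏ w', P.wordProb ch (b w')

theorem Input.bookProb_mem :
    P.bookProb ch (M := M) (J := J) ∈ stdSimplex ℝ (Fin M → Word U₁ X₁ U₂ M J) :=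
  pi_mem_stdSimplex (fun _ => P.wordProb ch) fun _ => P.wordProb_mem ch

theorem Input.sum_bookProb_eval (v : Fin M) (g : Word U₁ X₁ U₂ M J → ℝ) :
    ∑ b, P.bookProb ch b * g (b v) = ∑ c, P.wordProb ch c * g c :=
  sum_pi_eval (fun _ => P.wordProb ch) (fun _ => (P.wordProb_mem ch).2) v g

/-- The kernel at the letters of the word `c` with the indices `w` and `j`. -/
noncomputable def Input.wordKernel (c : Word U₁ X₁ U₂ M J) (w : Fin M) (j : Fin J) :
    S × X₂ × Y₂ × Y₃ → ℝ :=
  P.kernel ch c.1 (c.2.1 w) (c.2.2 j)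

/-- With a fixed index and the state drawn from the posterior, the letters in use, the state and the
outputs have the single-letter joint law. Errors of the true messages thereby become tails under
that law. -/
theorem Input.sum_bookProb_kernel (w w' : Fin M) (j : Fin J)
    (φ : U₁ → X₁ → U₂ → S × X₂ × Y₂ × Y₃ → ℝ) :
    ∑ b : Fin M → Word U₁ X₁ U₂ M J, P.bookProb ch b *
        ∑ t, P.wordKernel ch (b w') w j t * φ (b w').1 ((b w').2.1 w) ((b w').2.2 j) t =
      ∑ z, P.joint ch z * (fun (s, u₁, u₂, x₁, x₂, y₂, y₃) => φ u₁ x₁ u₂ (s, x₂, y₂, y₃)) z := by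
  rw [← P.sum_kernel_eq_sum_joint ch φ, ← P.sum_wordProb_eval ch w j,
    ← P.sum_bookProb_eval ch w']
  simp only [Input.wordKernel]

/-- A wrong new message passes the test of the relay with small probability. -/
theorem Input.sum_bookProb_relay_le {A : U₁ → X₁ → S → Y₂ → Prop} {a : ℝ} (ha : 0 ≤ a)
    (hA : ∀ u₁ s y₂, ∑ x₁, P.PX₁ u₁ x₁ * ind (A u₁ x₁ s y₂) ≤ a)
    {v w : Fin M} (hvw : v ≠ w) (w' : Fin M) (j : Fin J) :
    ∑ b : Fin M → Word U₁ X₁ U₂ M J, P.bookProb ch b *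
        ∑ t, P.wordKernel ch (b w') w j t * ind (A (b w').1 ((b w').2.1 v) t.1 t.2.2.1) ≤ a := by
  rw [P.sum_bookProb_eval ch w' (fun c => ∑ t, P.wordKernel ch c w j t *
    ind (A c.1 (c.2.1 v) t.1 t.2.2.1))]
  unfold Input.wordKernel
  rw [P.sum_wordProb_eval_two ch hvw j (fun u₁ x x' u₂ => ∑ t, P.kernel ch u₁ x' u₂ t *
    ind (A u₁ x t.1 t.2.2.1))]
  have h : ∀ u₁, ∑ x, ∑ x', P.PX₁ u₁ x * P.PX₁ u₁ x' *
      ∑ u₂, P.aux ch u₁ u₂ * ∑ t, P.kernel ch u₁ x' u₂ t * ind (A u₁ x t.1 t.2.2.1) ≤ a := by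
    intro u₁
    -- Given `u₁`, the wrong letter `x` is independent of the sent letter `x'` and its outputs. It
    -- is averaged first, with the state and output fixed, where `hA` applies.
    rw [Finset.sum_comm]
    calc ∑ x', ∑ x, P.PX₁ u₁ x * P.PX₁ u₁ x' *
          ∑ u₂, P.aux ch u₁ u₂ * ∑ t, P.kernel ch u₁ x' u₂ t * ind (A u₁ x t.1 t.2.2.1)
        = ∑ x', P.PX₁ u₁ x' * ∑ u₂, P.aux ch u₁ u₂ * ∑ t, P.kernel ch u₁ x' u₂ t *
            ∑ x, P.PX₁ u₁ x * ind (A u₁ x t.1 t.2.2.1) := by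
          refine Finset.sum_congr rfl fun x' _ => ?_
          simp only [Finset.mul_sum]
          rw [Finset.sum_comm]
          refine Finset.sum_congr rfl fun u₂ _ => ?_
          rw [Finset.sum_comm]
          refine Finset.sum_congr rfl fun t _ => Finset.sum_congr rfl fun x _ => ?_
          ring
      _ ≤ ∑ x', P.PX₁ u₁ x' * ∑ u₂, P.aux ch u₁ u₂ * a := by
          gcongr with x' _ u₂ _
          · exact (P.PX₁_mem u₁).1 x'
          · exact (P.aux_mem ch u₁).1 u₂
          · calc ∑ t, P.kernel ch u₁ x' u₂ t * ∑ x, P.PX₁ u₁ x * ind (A u₁ x t.1 t.2.2.1)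
                ≤ ∑ t, P.kernel ch u₁ x' u₂ t * a := by
                  gcongr with t
                  · exact P.kernel_nonneg ch _ _ _ _
                  · exact hA _ _ _
              _ ≤ 1 * a := by
                  rw [← Finset.sum_mul]
                  exact mul_le_mul_of_nonneg_right (P.sum_kernel_le_one ch _ _ _) ha
              _ = a := one_mul a
      _ = a := by
          rw [← Finset.sum_mul, ← Finset.sum_mul, (P.aux_mem ch u₁).2, (P.PX₁_mem u₁).2]
          ring
  calc _ ≤ ∑ u₁, P.PU₁ u₁ * a := by
        gcongr with u₁
        · exact P.PU₁_mem.1 u₁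
        · exact h u₁
    _ = a := by rw [← Finset.sum_mul, P.PU₁_mem.2, one_mul]

/-- A wrong previous message passes the test of the destination with small probability. -/
theorem Input.sum_bookProb_destination_le {A : U₁ → X₁ → U₂ → Y₃ → Prop} {a : ℝ} (ha : 0 ≤ a)
    (hA : ∀ y₃, ∑ u₁, P.PU₁ u₁ * ∑ x₁, P.PX₁ u₁ x₁ *
      ∑ u₂, P.aux ch u₁ u₂ * ind (A u₁ x₁ u₂ y₃) ≤ a)
    {v' w' : Fin M} (hvw : v' ≠ w') (w : Fin M) (i j : Fin J) :
    ∑ b : Fin M → Word U₁ X₁ U₂ M J, P.bookProb ch b * ∑ t, P.wordKernel ch (b w') w j t *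
        ind (A (b v').1 ((b v').2.1 w) ((b v').2.2 i) t.2.2.2) ≤ a := by
  rw [show (∑ b : Fin M → Word U₁ X₁ U₂ M J, P.bookProb ch b * ∑ t, P.wordKernel ch (b w') w j t *
        ind (A (b v').1 ((b v').2.1 w) ((b v').2.2 i) t.2.2.2)) = _ from
    sum_pi_eval_two (fun _ => P.wordProb ch) (fun _ => (P.wordProb_mem ch).2) hvw
      (fun d c => ∑ t, P.wordKernel ch c w j t * ind (A d.1 (d.2.1 w) (d.2.2 i) t.2.2.2)),
    Finset.sum_comm]
  -- The whole word `d` of a wrong previous message, centre included, is independent of the output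
  -- produced by `c`. This is why `u₁` counts in the destination's information.
  have h : ∀ c : Word U₁ X₁ U₂ M J, ∑ d, P.wordProb ch d * P.wordProb ch c *
      ∑ t, P.wordKernel ch c w j t * ind (A d.1 (d.2.1 w) (d.2.2 i) t.2.2.2) ≤
      P.wordProb ch c * a := by
    intro c
    calc ∑ d, P.wordProb ch d * P.wordProb ch c *
          ∑ t, P.wordKernel ch c w j t * ind (A d.1 (d.2.1 w) (d.2.2 i) t.2.2.2)
        = P.wordProb ch c * ∑ t, P.wordKernel ch c w j t *
            ∑ d : Word U₁ X₁ U₂ M J,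
              P.wordProb ch d * ind (A d.1 (d.2.1 w) (d.2.2 i) t.2.2.2) := by
          simp only [Finset.mul_sum]
          rw [Finset.sum_comm]
          refine Finset.sum_congr rfl fun t _ => Finset.sum_congr rfl fun d _ => ?_
          ring
      _ ≤ P.wordProb ch c * (1 * a) := by
          refine mul_le_mul_of_nonneg_left ?_ ((P.wordProb_mem ch).1 c)
          refine le_trans ?_ (mul_le_mul_of_nonneg_right
            (P.sum_kernel_le_one ch c.1 (c.2.1 w) (c.2.2 j)) ha)
          rw [Finset.sum_mul]
          refine Finset.sum_le_sum fun t _ =>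
            mul_le_mul_of_nonneg_left ?_ (P.kernel_nonneg ch _ _ _ _)
          rw [P.sum_wordProb_eval ch w i (fun u₁ x₁ u₂ => ind (A u₁ x₁ u₂ t.2.2.2))]
          exact hA _
      _ = _ := by rw [one_mul]
  calc _ ≤ ∑ c : Word U₁ X₁ U₂ M J, P.wordProb ch c * a := Finset.sum_le_sum fun c _ => h c
    _ = a := by rw [← Finset.sum_mul, (P.wordProb_mem ch).2, one_mul]

/-- The states are well covered by the posteriors of the auxiliary letters of a random word. -/
theorem Input.sum_bookProb_covering_le (hJ : 0 < J) {T : U₁ → U₂ → S → Prop} {κ δ : ℝ}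
    (hκ : 0 ≤ κ) (hδ : 0 < δ)
    (hT : ∀ u₁ u₂ s, T u₁ u₂ s → P.PU₂ u₁ s u₂ ≤ κ * P.aux ch u₁ u₂) (w' : Fin M) :
    ∑ b : Fin M → Word U₁ X₁ U₂ M J, P.bookProb ch b *
        ∑ s, max 0 (ch.Q s - (∑ j, P.posterior ch (b w').1 ((b w').2.2 j) s) / J) ≤
      ∑ z, P.joint ch z * (fun (s, u₁, u₂, _, _, _, _) => ind (¬T u₁ u₂ s)) z +
        (δ + κ / (δ * J)) := by
  have hcov : ∀ u₁ s, ∑ u : Fin J → U₂, (∏ j, P.aux ch u₁ (u j)) *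
      max 0 (ch.Q s - (∑ j, P.posterior ch u₁ (u j) s) / J) ≤
      ∑ u₂, ch.Q s * P.PU₂ u₁ s u₂ * ind (¬T u₁ u₂ s) + ch.Q s * (δ + κ / (δ * J)) := by
    intro u₁ s
    -- The likelihood is the posterior of a fixed `s`. Its mean over `u₂` is `Q s` by Bayes' rule,
    -- and on `T` the bound `hT` makes it at most `κ * Q s`.
    have h := soft_covering (T := fun u₂ => T u₁ u₂ s) hJ (P.aux_mem ch u₁)
      (fun u₂ => P.posterior_nonneg ch u₁ u₂ s) (ch.Q_mem.1 s) hκ hδ ?_ ?_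
    · simpa only [P.aux_mul_posterior] using h
    · simp only [P.aux_mul_posterior, ← Finset.mul_sum, (P.PU₂_mem u₁ s).2, mul_one]
    · intro u₂ hu
      have h0 := (P.aux_mem ch u₁).1 u₂
      unfold Input.posterior
      refine div_le_of_le_mul₀ h0 (mul_nonneg hκ (ch.Q_mem.1 s)) ?_
      have := mul_le_mul_of_nonneg_left (hT u₁ u₂ s hu) (ch.Q_mem.1 s)
      linarith
  rw [P.sum_bookProb_eval ch w' (fun c => ∑ s, max 0 (ch.Q s -
    (∑ j, P.posterior ch c.1 (c.2.2 j) s) / J)), P.sum_wordProb_mul]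
  simp only [← Finset.sum_mul, (pi_mem_stdSimplex (fun _ : Fin M => P.PX₁ _)
    fun _ => P.PX₁_mem _).2, one_mul]
  have hjoint : ∑ z, P.joint ch z * (fun (s, u₁, u₂, _, _, _, _) => ind (¬T u₁ u₂ s)) z =
      ∑ u₁, P.PU₁ u₁ * ∑ s, ∑ u₂, ch.Q s * P.PU₂ u₁ s u₂ * ind (¬T u₁ u₂ s) := by
    have hW : ∀ x₁ x₂ s, ∑ y₂, ∑ y₃, ch.W x₁ x₂ s (y₂, y₃) = 1 := by
      intro x₁ x₂ s
      rw [← Fintype.sum_prod_type']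
      exact (ch.W_mem x₁ x₂ s).2
    simp only [Input.joint, Fintype.sum_prod_type, ← Finset.sum_mul, ← Finset.mul_sum, hW,
      mul_one, (P.PX₂_mem _ _ _).2]
    rw [Finset.sum_comm]
    refine Finset.sum_congr rfl fun u₁ _ => ?_
    rw [Finset.mul_sum]
    refine Finset.sum_congr rfl fun s _ => ?_
    simp only [(P.PX₁_mem _).2, mul_one]
    rw [Finset.mul_sum]
    refine Finset.sum_congr rfl fun u₂ _ => ?_
    ring
  rw [hjoint]
  calc _ ≤ ∑ u₁, P.PU₁ u₁ * ∑ s, (∑ u₂, ch.Q s * P.PU₂ u₁ s u₂ * ind (¬T u₁ u₂ s) +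
          ch.Q s * (δ + κ / (δ * J))) := by
        refine Finset.sum_le_sum fun u₁ _ => mul_le_mul_of_nonneg_left ?_ (P.PU₁_mem.1 u₁)
        simp only [Finset.mul_sum]
        rw [Finset.sum_comm]
        refine Finset.sum_le_sum fun s _ => ?_
        simpa only [Finset.mul_sum] using hcov u₁ s
    _ = _ := by
        simp only [Finset.sum_add_distrib, ← Finset.sum_mul, ch.Q_mem.2, mul_add,
          P.PU₁_mem.2, one_mul]

end RandomCoding

/-! ### From code books to block codes -/

section CodeBooks

variable {X₁ X₂ S Y₂ Y₃ U₁ U₂ : Type*}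

theorem sum_mul_sum_mul_sum_comm {α β γ : Type*} [Fintype α] [Fintype β] (s : Finset γ)
    (p : α → ℝ) (k : α → β → ℝ) (f : α → γ → β → ℝ) :
    ∑ a, p a * ∑ b, k a b * ∑ c ∈ s, f a c b = ∑ c ∈ s, ∑ a, p a * ∑ b, k a b * f a c b := by
  rw [Finset.sum_comm]
  refine Finset.sum_congr rfl fun a _ => ?_
  rw [← Finset.mul_sum, Finset.sum_comm]
  simp only [Finset.mul_sum]

theorem sum_mul_sum_add_div_comm {α β γ ι : Type*} [Fintype α] [Fintype β] [Fintype γ]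
    [Fintype ι] (p : α → ℝ) (m k : ℝ) (f : β → α → ℝ) (g : β → γ → ι → α → ℝ) :
    ∑ a, p a * ∑ b, (m * f b a + (∑ c, ∑ i, g b c i a) / k) =
      ∑ b, (m * ∑ a, p a * f b a + (∑ c, ∑ i, ∑ a, p a * g b c i a) / k) := by
  simp only [Finset.mul_sum (s := univ (α := β))]
  rw [Finset.sum_comm]
  refine Finset.sum_congr rfl fun b _ => ?_
  have h : ∀ a, p a * (m * f b a + (∑ c, ∑ i, g b c i a) / k) =
      m * (p a * f b a) + (p a * ∑ c, ∑ i, g b c i a) / k := fun a => by ring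
  simp only [h, Finset.sum_add_distrib, ← Finset.mul_sum, ← Finset.sum_div]
  congr 2
  simp only [Finset.mul_sum]
  rw [Finset.sum_comm]
  exact Finset.sum_congr rfl fun c _ => Finset.sum_comm

variable {M J : ℕ}

/-- The block code given by a code book, by the tests `A₁` and `A₂` of the relay and of the
destination, and by the relay inputs. -/
noncomputable def bookCode [Nonempty (Fin M)] (A₁ : U₁ → X₁ → S → Y₂ → Prop)
    (A₂ : U₁ → X₁ → U₂ → Y₃ → Prop) (b : Fin M → Word U₁ X₁ U₂ M J) (r : Fin M → S → X₂) :
    BlockCode X₁ X₂ S Y₂ Y₃ M where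
  source w w' := (b w').2.1 w
  relay := r
  relayDecode w' s y₂ := Classical.epsilon fun w => A₁ (b w').1 ((b w').2.1 w) s y₂
  decode w y₃ := Classical.epsilon fun w' => ∃ j, A₂ (b w').1 ((b w').2.1 w) ((b w').2.2 j) y₃

theorem epsilon_eq_of_unique {ι : Type*} [Nonempty ι] {p : ι → Prop} {i : ι} (hi : p i)
    (h : ∀ k, k ≠ i → ¬p k) : Classical.epsilon p = i := by
  by_contra hne
  exact h _ hne (Classical.epsilon_spec ⟨i, hi⟩)

/-- A union bound: if the true letters pass both tests and no wrong ones do, both choices are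
forced. The index `j` is free because the destination accepts any index, so the bound can later be
averaged over `j`. -/
theorem ind_bookCode_fails_le [Nonempty (Fin M)] (A₁ : U₁ → X₁ → S → Y₂ → Prop)
    (A₂ : U₁ → X₁ → U₂ → Y₃ → Prop) (b : Fin M → Word U₁ X₁ U₂ M J) (r : Fin M → S → X₂)
    (w w' : Fin M) (s : S) (y : Y₂ × Y₃) (j : Fin J) :
    ind ((bookCode A₁ A₂ b r).Fails w w' s y) ≤
      ind (¬A₁ (b w').1 ((b w').2.1 w) s y.1) +
        ind (¬A₂ (b w').1 ((b w').2.1 w) ((b w').2.2 j) y.2) +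
      ∑ v ∈ univ.erase w, ind (A₁ (b w').1 ((b w').2.1 v) s y.1) +
      ∑ v' ∈ univ.erase w', ∑ i, ind (A₂ (b v').1 ((b v').2.1 w) ((b v').2.2 i) y.2) := by
  have h3 : 0 ≤ ∑ v ∈ univ.erase w, ind (A₁ (b w').1 ((b w').2.1 v) s y.1) :=
    Finset.sum_nonneg fun _ _ => ind_nonneg _
  have h4 : 0 ≤ ∑ v' ∈ univ.erase w', ∑ i, ind (A₂ (b v').1 ((b v').2.1 w) ((b v').2.2 i) y.2) :=
    Finset.sum_nonneg fun _ _ => Finset.sum_nonneg fun _ _ => ind_nonneg _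
  have h1 := ind_nonneg (¬A₁ (b w').1 ((b w').2.1 w) s y.1)
  have h2 := ind_nonneg (¬A₂ (b w').1 ((b w').2.1 w) ((b w').2.2 j) y.2)
  have hle := ind_le_one ((bookCode A₁ A₂ b r).Fails w w' s y)
  by_cases c1 : A₁ (b w').1 ((b w').2.1 w) s y.1
  swap
  · have := ind_of_true c1
    linarith
  by_cases c2 : A₂ (b w').1 ((b w').2.1 w) ((b w').2.2 j) y.2
  swap
  · have := ind_of_true c2
    linarith
  by_cases c3 : ∃ v, v ≠ w ∧ A₁ (b w').1 ((b w').2.1 v) s y.1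
  · obtain ⟨v, hv, hA⟩ := c3
    have := Finset.single_le_sum (f := fun v => ind (A₁ (b w').1 ((b w').2.1 v) s y.1))
      (fun _ _ => ind_nonneg _) (Finset.mem_erase.2 ⟨hv, Finset.mem_univ v⟩)
    simp only [ind_of_true hA] at this
    linarith
  by_cases c4 : ∃ v', v' ≠ w' ∧ ∃ i, A₂ (b v').1 ((b v').2.1 w) ((b v').2.2 i) y.2
  · obtain ⟨v', hv, i, hA⟩ := c4
    have e1 := Finset.single_le_sum
      (f := fun v' => ∑ i, ind (A₂ (b v').1 ((b v').2.1 w) ((b v').2.2 i) y.2))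
      (fun _ _ => Finset.sum_nonneg fun _ _ => ind_nonneg _)
      (Finset.mem_erase.2 ⟨hv, Finset.mem_univ v'⟩)
    have e2 := Finset.single_le_sum
      (f := fun i => ind (A₂ (b v').1 ((b v').2.1 w) ((b v').2.2 i) y.2))
      (fun _ _ => ind_nonneg _) (Finset.mem_univ i)
    simp only [ind_of_true hA] at e1 e2
    linarith
  push Not at c3 c4
  rw [ind_of_false]
  · linarith
  · rintro (h | h)
    · exact h (epsilon_eq_of_unique c1 c3)
    · exact h (epsilon_eq_of_unique ⟨j, c2⟩ fun v' hv' ⟨i, hi⟩ => c4 v' hv' i hi)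

variable [Fintype X₁] [Fintype X₂] [Fintype S] [Fintype Y₂] [Fintype Y₃] [Fintype U₁]
  [Fintype U₂] (P : Input X₁ X₂ S U₁ U₂) (ch : Channel X₁ X₂ S Y₂ Y₃)

/-- With the best relay inputs, the error is not larger than with a relay that draws the
auxiliary letter from the posterior, up to the failure of covering. -/
theorem exists_relay_sum_err_le [Nonempty X₂] [Nonempty (Fin M)] (hJ : 0 < J)
    (A₁ : U₁ → X₁ → S → Y₂ → Prop)
    (A₂ : U₁ → X₁ → U₂ → Y₃ → Prop) (b : Fin M → Word U₁ X₁ U₂ M J) (r₀ : Fin M → S → X₂) :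
    ∃ r : Fin M → S → X₂, ∑ w', ∑ w, (bookCode A₁ A₂ b r).err ch w w' ≤
      ∑ w', (M * ∑ s, max 0 (ch.Q s - (∑ j, P.posterior ch (b w').1 ((b w').2.2 j) s) / J) +
        (∑ j, ∑ w, ∑ t, P.wordKernel ch (b w') w j t *
          ind ((bookCode A₁ A₂ b r₀).Fails w w' t.1 t.2.2)) / J) := by
  have hJ' : (0 : ℝ) < J := by exact_mod_cast hJ
  -- Failure depends on the decoders alone, not on the relay inputs, so any `r₀` describes it.
  set F : Fin M → Fin M → S → Y₂ × Y₃ → Prop := (bookCode A₁ A₂ b r₀).Fails with hF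
  let cost : Fin M → S → X₂ → ℝ := fun w' s x₂ =>
    ∑ w, ∑ y, ch.W ((b w').2.1 w) x₂ s y * ind (F w w' s y)
  -- The cost does not involve `j`, so one minimiser is at least as good as drawing `x₂` from `PX₂`
  -- for every index at once.
  have hmin : ∀ w' s, ∃ x₂, ∀ x, cost w' s x₂ ≤ cost w' s x := fun w' s =>
    Finite.exists_min (cost w' s)
  choose r hr using hmin
  have hcost0 : ∀ w' s x, 0 ≤ cost w' s x := fun w' s x =>
    Finset.sum_nonneg fun w _ => Finset.sum_nonneg fun y _ =>
      mul_nonneg ((ch.W_mem _ _ _).1 _) (ind_nonneg _)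
  have hcostM : ∀ w' s x, cost w' s x ≤ M := by
    intro w' s x
    calc cost w' s x ≤ ∑ w : Fin M, (1 : ℝ) := by
          refine Finset.sum_le_sum fun w _ => ?_
          rw [← (ch.W_mem ((b w').2.1 w) x s).2]
          exact Finset.sum_le_sum fun y _ =>
            mul_le_of_le_one_right ((ch.W_mem _ _ _).1 _) (ind_le_one _)
      _ = M := by simp
  refine ⟨r, Finset.sum_le_sum fun w' _ => ?_⟩
  set L : Fin J → S → ℝ := fun j s => P.posterior ch (b w').1 ((b w').2.2 j) s with hL
  have hL0 : ∀ j s, 0 ≤ L j s := fun j s => P.posterior_nonneg ch _ _ _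
  have hlhs : ∑ w, (bookCode A₁ A₂ b r).err ch w w' = ∑ s, ch.Q s * cost w' s (r w' s) := by
    simp only [BlockCode.err, cost]
    rw [Finset.sum_comm]
    refine Finset.sum_congr rfl fun s _ => ?_
    rw [Finset.mul_sum]
    rfl
  have hrhs : ∑ j, ∑ w, ∑ t, P.wordKernel ch (b w') w j t * ind (F w w' t.1 t.2.2) =
      ∑ s, ∑ j, L j s * ∑ x₂, P.PX₂ (b w').1 ((b w').2.2 j) s x₂ * cost w' s x₂ := by
    rw [Finset.sum_comm (γ := S)]
    refine Finset.sum_congr rfl fun j _ => ?_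
    simp only [Input.wordKernel, Input.kernel, Fintype.sum_prod_type, cost, Finset.mul_sum]
    rw [Finset.sum_comm]
    refine Finset.sum_congr rfl fun s _ => ?_
    rw [Finset.sum_comm]
    refine Finset.sum_congr rfl fun x₂ _ => Finset.sum_congr rfl fun w _ =>
      Finset.sum_congr rfl fun y₂ _ => Finset.sum_congr rfl fun y₃ _ => ?_
    simp only [hL]; ring
  rw [hlhs, hrhs, Finset.sum_div, Finset.mul_sum, ← Finset.sum_add_distrib]
  refine Finset.sum_le_sum fun s _ => ?_
  -- The true state probability is replaced by the averaged posterior; the uncovered excess costs at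
  -- most `M`.
  have h1 : ch.Q s * cost w' s (r w' s) ≤
      M * max 0 (ch.Q s - (∑ j, L j s) / J) + (∑ j, L j s) / J * cost w' s (r w' s) := by
    have e1 : (ch.Q s - (∑ j, L j s) / J) * cost w' s (r w' s) ≤
        max 0 (ch.Q s - (∑ j, L j s) / J) * cost w' s (r w' s) :=
      mul_le_mul_of_nonneg_right (le_max_right _ _) (hcost0 _ _ _)
    have e2 : max 0 (ch.Q s - (∑ j, L j s) / J) * cost w' s (r w' s) ≤
        max 0 (ch.Q s - (∑ j, L j s) / J) * M :=
      mul_le_mul_of_nonneg_left (hcostM _ _ _) (le_max_left _ _)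
    linarith
  have h2 : (∑ j, L j s) / J * cost w' s (r w' s) ≤
      (∑ j, L j s * ∑ x₂, P.PX₂ (b w').1 ((b w').2.2 j) s x₂ * cost w' s x₂) / J := by
    rw [div_mul_eq_mul_div, Finset.sum_mul]
    gcongr with j
    · exact hL0 _ _
    · calc cost w' s (r w' s)
          = ∑ x₂, P.PX₂ (b w').1 ((b w').2.2 j) s x₂ * cost w' s (r w' s) := by
            rw [← Finset.sum_mul, (P.PX₂_mem _ _ _).2, one_mul]
        _ ≤ _ := Finset.sum_le_sum fun x _ =>
            mul_le_mul_of_nonneg_left (hr w' s x) ((P.PX₂_mem _ _ _).1 _)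
  linarith

/-- The expected failure probability when the auxiliary letter has the index `j` and the state
is drawn from the posterior. -/
theorem sum_bookProb_fails_le [Nonempty (Fin M)]
    {A₁ : U₁ → X₁ → S → Y₂ → Prop} {A₂ : U₁ → X₁ → U₂ → Y₃ → Prop} {a₁ a₂ : ℝ}
    (ha₁ : 0 ≤ a₁) (ha₂ : 0 ≤ a₂)
    (hA₁ : ∀ u₁ s y₂, ∑ x₁, P.PX₁ u₁ x₁ * ind (A₁ u₁ x₁ s y₂) ≤ a₁)
    (hA₂ : ∀ y₃, ∑ u₁, P.PU₁ u₁ * ∑ x₁, P.PX₁ u₁ x₁ *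
      ∑ u₂, P.aux ch u₁ u₂ * ind (A₂ u₁ x₁ u₂ y₃) ≤ a₂)
    (r : Fin M → S → X₂) (w w' : Fin M) (j : Fin J) :
    ∑ b : Fin M → Word U₁ X₁ U₂ M J, P.bookProb ch b *
      ∑ t, P.wordKernel ch (b w') w j t * ind ((bookCode A₁ A₂ b r).Fails w w' t.1 t.2.2) ≤
    ∑ z, P.joint ch z * (fun (s, u₁, _, x₁, _, y₂, _) => ind (¬A₁ u₁ x₁ s y₂)) z +
    ∑ z, P.joint ch z * (fun (_, u₁, u₂, x₁, _, _, y₃) => ind (¬A₂ u₁ x₁ u₂ y₃)) z +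
    M * a₁ + M * J * a₂ := by
  have hM1 : ((univ.erase w).card : ℝ) ≤ M := by
    have := Finset.card_le_univ (univ.erase w)
    rw [Fintype.card_fin] at this
    exact_mod_cast this
  have hM2 : ((univ.erase w').card : ℝ) ≤ M := by
    have := Finset.card_le_univ (univ.erase w')
    rw [Fintype.card_fin] at this
    exact_mod_cast this
  calc _ ≤ ∑ b : Fin M → Word U₁ X₁ U₂ M J, P.bookProb ch b *
      ∑ t, P.wordKernel ch (b w') w j t *
        (ind (¬A₁ (b w').1 ((b w').2.1 w) t.1 t.2.2.1) +
        ind (¬A₂ (b w').1 ((b w').2.1 w) ((b w').2.2 j) t.2.2.2) +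
        ∑ v ∈ univ.erase w, ind (A₁ (b w').1 ((b w').2.1 v) t.1 t.2.2.1) +
        ∑ v' ∈ univ.erase w', ∑ i,
          ind (A₂ (b v').1 ((b v').2.1 w) ((b v').2.2 i) t.2.2.2)) := by
        refine Finset.sum_le_sum fun b _ => mul_le_mul_of_nonneg_left
          (Finset.sum_le_sum fun t _ => mul_le_mul_of_nonneg_left ?_ (P.kernel_nonneg ch _ _ _ _))
          ((P.bookProb_mem ch).1 b)
        exact ind_bookCode_fails_le A₁ A₂ b r w w' t.1 t.2.2 j
    _ = ∑ b : Fin M → Word U₁ X₁ U₂ M J, P.bookProb ch b *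
          ∑ t, P.wordKernel ch (b w') w j t * ind (¬A₁ (b w').1 ((b w').2.1 w) t.1 t.2.2.1) +
        ∑ b : Fin M → Word U₁ X₁ U₂ M J, P.bookProb ch b * ∑ t, P.wordKernel ch (b w') w j t *
          ind (¬A₂ (b w').1 ((b w').2.1 w) ((b w').2.2 j) t.2.2.2) +
        ∑ v ∈ univ.erase w, ∑ b : Fin M → Word U₁ X₁ U₂ M J, P.bookProb ch b *
          ∑ t, P.wordKernel ch (b w') w j t * ind (A₁ (b w').1 ((b w').2.1 v) t.1 t.2.2.1) +
        ∑ v' ∈ univ.erase w', ∑ i, ∑ b : Fin M → Word U₁ X₁ U₂ M J, P.bookProb ch b *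
          ∑ t, P.wordKernel ch (b w') w j t *
            ind (A₂ (b v').1 ((b v').2.1 w) ((b v').2.2 i) t.2.2.2) := by
        simp only [mul_add, Finset.sum_add_distrib, sum_mul_sum_mul_sum_comm]
    _ ≤ _ := by
        gcongr ?_ + ?_ + ?_ + ?_
        · exact (P.sum_bookProb_kernel ch w w' j
            fun u₁ x₁ _ t => ind (¬A₁ u₁ x₁ t.1 t.2.2.1)).le
        · exact (P.sum_bookProb_kernel ch w w' j
            fun u₁ x₁ u₂ t => ind (¬A₂ u₁ x₁ u₂ t.2.2.2)).le
        · calc _ ≤ ∑ v ∈ univ.erase w, a₁ := Finset.sum_le_sum fun v hv =>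
                P.sum_bookProb_relay_le ch ha₁ hA₁ (Finset.ne_of_mem_erase hv) w' j
            _ ≤ M * a₁ := by
                rw [Finset.sum_const, nsmul_eq_mul]
                exact mul_le_mul_of_nonneg_right hM1 ha₁
        · calc _ ≤ ∑ v' ∈ univ.erase w', ∑ i : Fin J, a₂ := Finset.sum_le_sum fun v' hv' =>
                Finset.sum_le_sum fun i _ => P.sum_bookProb_destination_le ch ha₂ hA₂
                  (Finset.ne_of_mem_erase hv') w i j
            _ ≤ M * J * a₂ := by
                simp only [Finset.sum_const, nsmul_eq_mul, Finset.card_univ, Fintype.card_fin]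
                rw [← mul_assoc]
                gcongr

/-- One-shot achievability by random coding. -/
theorem exists_blockCode [Nonempty X₂] (hM : 0 < M) (hJ : 0 < J)
    {A₁ : U₁ → X₁ → S → Y₂ → Prop} {A₂ : U₁ → X₁ → U₂ → Y₃ → Prop} {T : U₁ → U₂ → S → Prop}
    {a₁ a₂ κ δ : ℝ} (ha₁ : 0 ≤ a₁) (ha₂ : 0 ≤ a₂) (hκ : 0 ≤ κ) (hδ : 0 < δ)
    (hA₁ : ∀ u₁ s y₂, ∑ x₁, P.PX₁ u₁ x₁ * ind (A₁ u₁ x₁ s y₂) ≤ a₁)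
    (hA₂ : ∀ y₃, ∑ u₁, P.PU₁ u₁ * ∑ x₁, P.PX₁ u₁ x₁ *
      ∑ u₂, P.aux ch u₁ u₂ * ind (A₂ u₁ x₁ u₂ y₃) ≤ a₂)
    (hT : ∀ u₁ u₂ s, T u₁ u₂ s → P.PU₂ u₁ s u₂ ≤ κ * P.aux ch u₁ u₂) :
    ∃ c : BlockCode X₁ X₂ S Y₂ Y₃ M, ∑ w', ∑ w, c.err ch w w' ≤ M ^ 2 *
      (∑ z, P.joint ch z * (fun (s, u₁, _, x₁, _, y₂, _) => ind (¬A₁ u₁ x₁ s y₂)) z +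
        ∑ z, P.joint ch z * (fun (_, u₁, u₂, x₁, _, _, y₃) => ind (¬A₂ u₁ x₁ u₂ y₃)) z +
        ∑ z, P.joint ch z * (fun (s, u₁, u₂, _, _, _, _) => ind (¬T u₁ u₂ s)) z +
        M * a₁ + M * J * a₂ + (δ + κ / (δ * J))) := by
  have : Nonempty (Fin M) := ⟨⟨0, hM⟩⟩
  have hJ' : (0 : ℝ) < J := by exact_mod_cast hJ
  let r₀ : Fin M → S → X₂ := fun _ _ => Classical.arbitrary X₂
  choose r hr using fun b => exists_relay_sum_err_le P ch (M := M) hJ A₁ A₂ b r₀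
  suffices h : ∃ b, ∑ w', ∑ w, (bookCode A₁ A₂ b (r b)).err ch w w' ≤ _ from
    let ⟨b, hb⟩ := h; ⟨_, hb⟩
  refine exists_le_of_sum_mul_le (P.bookProb_mem ch) ?_
  set p₁ := ∑ z, P.joint ch z * (fun (s, u₁, _, x₁, _, y₂, _) => ind (¬A₁ u₁ x₁ s y₂)) z
  set p₂ := ∑ z, P.joint ch z * (fun (_, u₁, u₂, x₁, _, _, y₃) => ind (¬A₂ u₁ x₁ u₂ y₃)) z
  set p₃ := ∑ z, P.joint ch z * (fun (s, u₁, u₂, _, _, _, _) => ind (¬T u₁ u₂ s)) z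
  calc _ ≤ ∑ b, P.bookProb ch b * _ := Finset.sum_le_sum fun b _ =>
        mul_le_mul_of_nonneg_left (hr b) ((P.bookProb_mem ch).1 b)
    _ = ∑ w', (M * ∑ b, P.bookProb ch b * ∑ s, max 0 (ch.Q s -
            (∑ j, P.posterior ch (b w').1 ((b w').2.2 j) s) / J) +
          (∑ j, ∑ w, ∑ b, P.bookProb ch b * ∑ t, P.wordKernel ch (b w') w j t *
            ind ((bookCode A₁ A₂ b r₀).Fails w w' t.1 t.2.2)) / J) := by
        exact sum_mul_sum_add_div_comm _ _ _ _ _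
    _ ≤ ∑ w' : Fin M, (M * (p₃ + (δ + κ / (δ * J))) +
          (∑ j : Fin J, ∑ w : Fin M, (p₁ + p₂ + M * a₁ + M * J * a₂)) / J) := by
        gcongr with w' _ j _ w _
        · exact P.sum_bookProb_covering_le ch hJ hκ hδ hT w'
        · exact sum_bookProb_fails_le P ch ha₁ ha₂ hA₁ hA₂ r₀ w w' j
    _ = _ := by
        simp only [Finset.sum_const, nsmul_eq_mul, Finset.card_univ, Fintype.card_fin]
        field_simp
        ring

end CodeBooks

/-! ### Information densities and the weak law -/

section Densities

variable {Ω α β γ : Type*} [Fintype Ω]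

theorem law_eq_sum_ind (p : Ω → ℝ) (A : Ω → α) (a : α) :
    law p A a = ∑ ω, p ω * ind (A ω = a) := by
  unfold law ind
  refine Finset.sum_congr rfl fun ω _ => ?_
  split_ifs <;> simp

theorem law_nonneg {p : Ω → ℝ} (hp : ∀ ω, 0 ≤ p ω) (A : Ω → α) (a : α) : 0 ≤ law p A a := by
  rw [law_eq_sum_ind]
  exact Finset.sum_nonneg fun ω _ => mul_nonneg (hp ω) (ind_nonneg _)

theorem law_pos {p : Ω → ℝ} (hp : ∀ ω, 0 ≤ p ω) (A : Ω → α) {ω : Ω} (h : 0 < p ω) :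
    0 < law p A (A ω) := by
  rw [law_eq_sum_ind]
  refine Finset.sum_pos' (fun ω _ => mul_nonneg (hp ω) (ind_nonneg _))
    ⟨ω, Finset.mem_univ ω, ?_⟩
  rwa [ind_of_true rfl, mul_one]

variable [Fintype α]

theorem sum_law_mul (p : Ω → ℝ) (A : Ω → α) (g : α → ℝ) :
    ∑ a, law p A a * g a = ∑ ω, p ω * g (A ω) := by
  classical
  simp only [law_eq_sum_ind, Finset.sum_mul]
  rw [Finset.sum_comm]
  refine Finset.sum_congr rfl fun ω _ => ?_
  simp [ind]

theorem sum_law_pair (p : Ω → ℝ) (A : Ω → α) (B : Ω → β) (b : β) :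
    ∑ a, law p (fun ω => (A ω, B ω)) (a, b) = law p B b := by
  classical
  simp only [law_eq_sum_ind]
  rw [Finset.sum_comm]
  refine Finset.sum_congr rfl fun ω _ => ?_
  rw [← Finset.mul_sum]
  by_cases h : B ω = b <;> simp [ind, h]

theorem entropy_eq_sum_log (p : Ω → ℝ) (A : Ω → α) :
    entropy p A = ∑ ω, p ω * -Real.log (law p A (A ω)) := by
  rw [← sum_law_mul p A fun a => -Real.log (law p A a)]
  refine Finset.sum_congr rfl fun a _ => ?_
  rw [Real.negMulLog]; ring

variable [Fintype β]

theorem mutualInfo_eq_sum_log (p : Ω → ℝ) (A : Ω → α) (B : Ω → β) :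
    mutualInfo p A B = ∑ ω, p ω * (Real.log (law p (fun ω => (A ω, B ω)) (A ω, B ω)) -
      Real.log (law p B (B ω)) - Real.log (law p A (A ω))) := by
  simp only [mutualInfo, condEntropy, entropy_eq_sum_log, ← Finset.sum_sub_distrib]
  exact Finset.sum_congr rfl fun ω _ => by ring

variable [Fintype γ]

theorem condMutualInfo_eq_sum_log (p : Ω → ℝ) (A : Ω → α) (B : Ω → β) (C : Ω → γ) :
    condMutualInfo p A B C = ∑ ω, p ω *
      (Real.log (law p (fun ω => (A ω, B ω, C ω)) (A ω, B ω, C ω)) -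
        Real.log (law p (fun ω => (B ω, C ω)) (B ω, C ω)) -
        (Real.log (law p (fun ω => (A ω, C ω)) (A ω, C ω)) - Real.log (law p C (C ω)))) := by
  simp only [condMutualInfo, condEntropy, entropy_eq_sum_log, ← Finset.sum_sub_distrib]
  exact Finset.sum_congr rfl fun ω _ => by ring

/-- The weak law of large numbers for the logarithm of a density `g / f`. -/
theorem exists_sum_pi_ind_density_le {p f g : Ω → ℝ} (hp : p ∈ stdSimplex ℝ Ω)
    (hf : ∀ ω, 0 < p ω → 0 < f ω) (hg : ∀ ω, 0 < p ω → 0 < g ω) {I : ℝ}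
    (hI : ∑ ω, p ω * (Real.log (g ω) - Real.log (f ω)) = I) {δ : ℝ} (hδ : 0 < δ) :
    ∃ C : ℝ, ∀ m : ℕ, 0 < m → ∑ z : Fin m → Ω, (∏ k, p (z k)) *
        ind (¬Real.exp (m * (I - δ)) * ∏ k, f (z k) ≤ ∏ k, g (z k)) ≤ C / m := by
  refine ⟨(∑ ω, p ω * (Real.log (g ω) - Real.log (f ω) - I) ^ 2) / δ ^ 2, fun m hm => ?_⟩
  have hm' : (0 : ℝ) < m := by exact_mod_cast hm
  set h : Ω → ℝ := fun ω => Real.log (g ω) - Real.log (f ω) - I with hh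
  have hcent : ∑ ω, p ω * h ω = 0 := by
    simp only [hh, mul_sub (p _) _ I, Finset.sum_sub_distrib, ← Finset.sum_mul, hp.2]
    rw [hI]; ring
  have hcheb := sum_pi_ind_le (ι := Fin m) p hp h hcent (t := m * δ) (by positivity)
  refine le_trans (Finset.sum_le_sum fun z _ => ?_) (hcheb.trans_eq ?_)
  -- Logarithms are taken only where every letter has positive probability; the other sequences have
  -- weight zero.
  · by_cases hz : ∀ k, 0 < p (z k)
    · refine mul_le_mul_of_nonneg_left (ind_mono fun hlt => ?_)
        (Finset.prod_nonneg fun k _ => hp.1 _)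
      rw [not_le] at hlt
      have hf' : ∀ k, 0 < f (z k) := fun k => hf _ (hz k)
      have hg' : ∀ k, 0 < g (z k) := fun k => hg _ (hz k)
      have h1 := Real.log_lt_log (Finset.prod_pos fun k _ => hg' k) hlt
      rw [Real.log_mul (Real.exp_pos _).ne' (Finset.prod_pos fun k _ => hf' k).ne', Real.log_exp,
        Real.log_prod fun k _ => (hg' k).ne', Real.log_prod fun k _ => (hf' k).ne'] at h1
      have h2 : ∑ k, h (z k) = ∑ k, Real.log (g (z k)) - ∑ k, Real.log (f (z k)) - m * I := by
        simp [hh, Finset.sum_sub_distrib]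
      refine le_trans ?_ (neg_le_abs _)
      rw [h2]; linarith
    · push Not at hz
      obtain ⟨k, hk⟩ := hz
      rw [Finset.prod_eq_zero (Finset.mem_univ k) (le_antisymm hk (hp.1 _)), zero_mul, zero_mul]
  · rw [Fintype.card_fin]
    simp only [hh]
    field_simp

end Densities

/-! ### Marginals of the joint law and its information quantities -/

section Marginals

variable {X₁ X₂ S Y₂ Y₃ U₁ U₂ : Type*} [Fintype X₁] [Fintype X₂] [Fintype S]
  [Fintype Y₂] [Fintype Y₃] [Fintype U₁] [Fintype U₂]
  (P : Input X₁ X₂ S U₁ U₂) (ch : Channel X₁ X₂ S Y₂ Y₃)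

theorem Input.sum_joint_mul (φ : S → U₁ → U₂ → X₁ → ℝ) :
    ∑ z, P.joint ch z * (fun (s, u₁, u₂, x₁, _, _, _) => φ s u₁ u₂ x₁) z =
      ∑ s, ∑ u₁, ∑ u₂, ∑ x₁,
        ch.Q s * P.PU₁ u₁ * P.PX₁ u₁ x₁ * P.PU₂ u₁ s u₂ * φ s u₁ u₂ x₁ := by
  have hW : ∀ x₁ x₂ s, ∑ y₂, ∑ y₃, ch.W x₁ x₂ s (y₂, y₃) = 1 := by
    intro x₁ x₂ s
    rw [← Fintype.sum_prod_type']
    exact (ch.W_mem x₁ x₂ s).2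
  simp only [Input.joint, Fintype.sum_prod_type, ← Finset.sum_mul, ← Finset.mul_sum, hW,
    mul_one, (P.PX₂_mem _ _ _).2]

theorem Input.joint_nonneg (z : S × U₁ × U₂ × X₁ × X₂ × Y₂ × Y₃) : 0 ≤ P.joint ch z := by
  obtain ⟨s, u₁, u₂, x₁, x₂, y₂, y₃⟩ := z
  have h1 := ch.Q_mem.1 s
  have h2 := P.PU₁_mem.1 u₁
  have h3 := (P.PX₁_mem u₁).1 x₁
  have h4 := (P.PU₂_mem u₁ s).1 u₂
  have h5 := (P.PX₂_mem u₁ u₂ s).1 x₂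
  have h6 := (ch.W_mem x₁ x₂ s).1 (y₂, y₃)
  simp only [Input.joint]
  positivity

theorem Input.joint_mem : P.joint ch ∈ stdSimplex ℝ (S × U₁ × U₂ × X₁ × X₂ × Y₂ × Y₃) := by
  refine ⟨P.joint_nonneg ch, ?_⟩
  have h := P.sum_joint_mul ch (fun _ _ _ _ => 1)
  simp only [mul_one] at h
  rw [h, Finset.sum_comm]
  simp only [← Finset.sum_mul, ← Finset.mul_sum, (P.PX₁_mem _).2, (P.PU₂_mem _ _).2,
    ch.Q_mem.2, P.PU₁_mem.2, mul_one, one_mul]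

theorem Input.factors_pos {s : S} {u₁ : U₁} {u₂ : U₂} {x₁ : X₁} {x₂ : X₂} {y₂ : Y₂} {y₃ : Y₃}
    (h : 0 < P.joint ch (s, u₁, u₂, x₁, x₂, y₂, y₃)) :
    0 < ch.Q s ∧ 0 < P.PU₁ u₁ ∧ 0 < P.PX₁ u₁ x₁ ∧ 0 < P.PU₂ u₁ s u₂ := by
  simp only [Input.joint] at h
  have h0 := h.ne'
  simp only [mul_ne_zero_iff] at h0
  obtain ⟨⟨⟨⟨⟨h1, h2⟩, h3⟩, h4⟩, -⟩, -⟩ := h0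
  exact ⟨(ch.Q_mem.1 s).lt_of_ne' h1, (P.PU₁_mem.1 u₁).lt_of_ne' h2,
    ((P.PX₁_mem u₁).1 x₁).lt_of_ne' h3, ((P.PU₂_mem u₁ s).1 u₂).lt_of_ne' h4⟩

theorem Input.aux_pos {s : S} {u₁ : U₁} {u₂ : U₂} (hQ : 0 < ch.Q s) (h : 0 < P.PU₂ u₁ s u₂) :
    0 < P.aux ch u₁ u₂ :=
  Finset.sum_pos' (fun s _ => mul_nonneg (ch.Q_mem.1 s) ((P.PU₂_mem u₁ s).1 u₂))
    ⟨s, Finset.mem_univ s, mul_pos hQ h⟩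

theorem Input.law_S_U₁ (s : S) (u₁ : U₁) :
    law (P.joint ch) (fun (s, u₁, _, _, _, _, _) => (s, u₁)) (s, u₁) = ch.Q s * P.PU₁ u₁ := by
  classical
  rw [law_eq_sum_ind]
  refine (P.sum_joint_mul ch fun s' u₁' _ _ => ind ((s', u₁') = (s, u₁))).trans ?_
  simp only [← Finset.sum_mul, ← Finset.mul_sum, (P.PX₁_mem _).2, (P.PU₂_mem _ _).2, mul_one]
  simp [ind, ite_and, Finset.sum_ite_irrel]

theorem Input.law_U₁ (u₁ : U₁) :
    law (P.joint ch) (fun (_, u₁, _, _, _, _, _) => u₁) u₁ = P.PU₁ u₁ := by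
  classical
  rw [law_eq_sum_ind]
  refine (P.sum_joint_mul ch fun _ u₁' _ _ => ind (u₁' = u₁)).trans ?_
  simp only [← Finset.sum_mul, ← Finset.mul_sum, (P.PX₁_mem _).2, (P.PU₂_mem _ _).2, mul_one]
  simp [ind, ← Finset.sum_mul, ch.Q_mem.2]

theorem Input.law_X₁_S_U₁ (x₁ : X₁) (s : S) (u₁ : U₁) :
    law (P.joint ch) (fun (s, u₁, _, x₁, _, _, _) => (x₁, s, u₁)) (x₁, s, u₁) =
      P.PX₁ u₁ x₁ * (ch.Q s * P.PU₁ u₁) := by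
  classical
  rw [law_eq_sum_ind]
  refine (P.sum_joint_mul ch fun s' u₁' _ x₁' => ind ((x₁', s', u₁') = (x₁, s, u₁))).trans ?_
  simp [ind, ite_and, Finset.sum_ite_irrel, ← Finset.mul_sum, (P.PU₂_mem _ _).2]
  ring

theorem Input.law_U₂_S_U₁ (u₂ : U₂) (s : S) (u₁ : U₁) :
    law (P.joint ch) (fun (s, u₁, u₂, _, _, _, _) => (u₂, s, u₁)) (u₂, s, u₁) =
      P.PU₂ u₁ s u₂ * (ch.Q s * P.PU₁ u₁) := by
  classical
  rw [law_eq_sum_ind]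
  refine (P.sum_joint_mul ch fun s' u₁' u₂' _ => ind ((u₂', s', u₁') = (u₂, s, u₁))).trans ?_
  simp only [← Finset.sum_mul, ← Finset.mul_sum, (P.PX₁_mem _).2, mul_one]
  simp [ind, ite_and, Finset.sum_ite_irrel]
  ring

theorem Input.law_U₂_U₁ (u₂ : U₂) (u₁ : U₁) :
    law (P.joint ch) (fun (_, u₁, u₂, _, _, _, _) => (u₂, u₁)) (u₂, u₁) =
      P.aux ch u₁ u₂ * P.PU₁ u₁ := by
  classical
  rw [law_eq_sum_ind]
  refine (P.sum_joint_mul ch fun _ u₁' u₂' _ => ind ((u₂', u₁') = (u₂, u₁))).trans ?_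
  simp only [← Finset.sum_mul, ← Finset.mul_sum, (P.PX₁_mem _).2, mul_one]
  simp only [ind, ite_and, Prod.mk.injEq, mul_ite, mul_one, mul_zero, Finset.sum_ite_eq',
    Finset.mem_univ, if_true, Input.aux, Finset.sum_mul]
  exact Finset.sum_congr rfl fun s _ => by ring

theorem Input.law_X₁_U₁_U₂ (x₁ : X₁) (u₁ : U₁) (u₂ : U₂) :
    law (P.joint ch) (fun (_, u₁, u₂, x₁, _, _, _) => (x₁, u₁, u₂)) (x₁, u₁, u₂) =
      P.PU₁ u₁ * P.PX₁ u₁ x₁ * P.aux ch u₁ u₂ := by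
  classical
  rw [law_eq_sum_ind]
  refine (P.sum_joint_mul ch fun _ u₁' u₂' x₁' => ind ((x₁', u₁', u₂') = (x₁, u₁, u₂))).trans ?_
  simp only [ind, ite_and, Prod.mk.injEq, mul_ite, mul_one, mul_zero, Finset.sum_ite_eq',
    Finset.mem_univ, if_true, Input.aux, Finset.mul_sum, Finset.sum_ite_irrel,
    Finset.sum_const_zero]
  exact Finset.sum_congr rfl fun s _ => by ring

/-- `P_{X₁|U₁,S,Y₂}`. -/
noncomputable def Input.relayPosterior (u₁ : U₁) (x₁ : X₁) (s : S) (y₂ : Y₂) : ℝ :=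
  law (P.joint ch) (fun (s, u₁, _, x₁, _, y₂, _) => (x₁, y₂, s, u₁)) (x₁, y₂, s, u₁) /
    law (P.joint ch) (fun (s, u₁, _, _, _, y₂, _) => (y₂, s, u₁)) (y₂, s, u₁)

/-- `P_{X₁,U₁,U₂|Y₃}`. -/
noncomputable def Input.destinationPosterior (u₁ : U₁) (x₁ : X₁) (u₂ : U₂) (y₃ : Y₃) : ℝ :=
  law (P.joint ch) (fun (_, u₁, u₂, x₁, _, _, y₃) => ((x₁, u₁, u₂), y₃)) ((x₁, u₁, u₂), y₃) /
    law (P.joint ch) (fun (_, _, _, _, _, _, y₃) => y₃) y₃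

theorem Input.relayPosterior_nonneg (u₁ : U₁) (x₁ : X₁) (s : S) (y₂ : Y₂) :
    0 ≤ P.relayPosterior ch u₁ x₁ s y₂ :=
  div_nonneg (law_nonneg (P.joint_nonneg ch) _ _) (law_nonneg (P.joint_nonneg ch) _ _)

theorem Input.destinationPosterior_nonneg (u₁ : U₁) (x₁ : X₁) (u₂ : U₂) (y₃ : Y₃) :
    0 ≤ P.destinationPosterior ch u₁ x₁ u₂ y₃ :=
  div_nonneg (law_nonneg (P.joint_nonneg ch) _ _) (law_nonneg (P.joint_nonneg ch) _ _)

/-- A conditional distribution, or zero when the conditioning event has probability zero. Being a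
subprobability is enough for the change of measure in `Input.sum_PX₁_pow_ind_le`. -/
theorem Input.sum_relayPosterior_le_one (u₁ : U₁) (s : S) (y₂ : Y₂) :
    ∑ x₁, P.relayPosterior ch u₁ x₁ s y₂ ≤ 1 := by
  unfold Input.relayPosterior
  rw [← Finset.sum_div]
  exact (congrArg (· / _) (sum_law_pair (P.joint ch) (fun (_, _, _, x₁, _, _, _) => x₁)
    (fun (s, u₁, _, _, _, y₂, _) => (y₂, s, u₁)) (y₂, s, u₁))).trans_le (div_self_le_one _)

theorem Input.sum_destinationPosterior_le_one (y₃ : Y₃) :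
    ∑ u₁, ∑ x₁, ∑ u₂, P.destinationPosterior ch u₁ x₁ u₂ y₃ ≤ 1 := by
  have h := sum_law_pair (P.joint ch) (fun (_, u₁, u₂, x₁, _, _, _) => (x₁, u₁, u₂))
    (fun (_, _, _, _, _, _, y₃) => y₃) y₃
  rw [Fintype.sum_prod_type] at h
  simp only [Fintype.sum_prod_type] at h
  rw [Finset.sum_comm] at h
  unfold Input.destinationPosterior
  simp only [← Finset.sum_div]
  exact (congrArg (· / _) h).trans_le (div_self_le_one _)

theorem Input.relayPosterior_pos {s : S} {u₁ : U₁} {u₂ : U₂} {x₁ : X₁} {x₂ : X₂} {y₂ : Y₂}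
    {y₃ : Y₃} (h : 0 < P.joint ch (s, u₁, u₂, x₁, x₂, y₂, y₃)) :
    0 < P.relayPosterior ch u₁ x₁ s y₂ :=
  div_pos (law_pos (P.joint_nonneg ch) (fun (s, u₁, _, x₁, _, y₂, _) => (x₁, y₂, s, u₁)) h)
    (law_pos (P.joint_nonneg ch) (fun (s, u₁, _, _, _, y₂, _) => (y₂, s, u₁)) h)

theorem Input.destinationPosterior_pos {s : S} {u₁ : U₁} {u₂ : U₂} {x₁ : X₁} {x₂ : X₂} {y₂ : Y₂}
    {y₃ : Y₃} (h : 0 < P.joint ch (s, u₁, u₂, x₁, x₂, y₂, y₃)) :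
    0 < P.destinationPosterior ch u₁ x₁ u₂ y₃ :=
  div_pos (law_pos (P.joint_nonneg ch) (fun (_, u₁, u₂, x₁, _, _, y₃) => ((x₁, u₁, u₂), y₃)) h)
    (law_pos (P.joint_nonneg ch) (fun (_, _, _, _, _, _, y₃) => y₃) h)

theorem Input.sum_joint_congr {f g : S × U₁ × U₂ × X₁ × X₂ × Y₂ × Y₃ → ℝ}
    (h : ∀ z, 0 < P.joint ch z → f z = g z) :
    ∑ z, P.joint ch z * f z = ∑ z, P.joint ch z * g z := by
  refine Finset.sum_congr rfl fun z _ => ?_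
  rcases (P.joint_nonneg ch z).eq_or_lt with h0 | h0
  · rw [← h0, zero_mul, zero_mul]
  · rw [h z h0]

/-- Given `U₁`, the letter `X₁` is independent of `S`, so the reference distribution in the density
is `PX₁`, from which wrong letters are drawn. -/
theorem Input.condMutualInfo_relay :
    condMutualInfo (P.joint ch) (fun (_, _, _, x₁, _, _, _) => x₁)
      (fun (_, _, _, _, _, y₂, _) => y₂) (fun (s, u₁, _, _, _, _, _) => (s, u₁)) =
    ∑ z, P.joint ch z * (Real.log ((fun (s, u₁, _, x₁, _, y₂, _) =>
        P.relayPosterior ch u₁ x₁ s y₂) z) -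
      Real.log ((fun (_, u₁, _, x₁, _, _, _) => P.PX₁ u₁ x₁) z)) := by
  rw [condMutualInfo_eq_sum_log]
  refine P.sum_joint_congr ch ?_
  rintro ⟨s, u₁, u₂, x₁, x₂, y₂, y₃⟩ h
  have h1 := law_pos (P.joint_nonneg ch) (fun (s, u₁, _, x₁, _, y₂, _) => (x₁, y₂, s, u₁)) h
  have h2 := law_pos (P.joint_nonneg ch) (fun (s, u₁, _, _, _, y₂, _) => (y₂, s, u₁)) h
  obtain ⟨hQ, hU, hX, -⟩ := P.factors_pos ch h
  have e1 := P.law_X₁_S_U₁ ch x₁ s u₁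
  have e2 := P.law_S_U₁ ch s u₁
  dsimp only at h1 h2 ⊢
  rw [Input.relayPosterior, Real.log_div h1.ne' h2.ne', e1, e2,
    Real.log_mul hX.ne' (mul_pos hQ hU).ne']
  ring

/-- The reference distribution is the law of the letters in a random word, since `X₁` and `U₂` are
independent given `U₁`. -/
theorem Input.mutualInfo_destination :
    mutualInfo (P.joint ch) (fun (_, u₁, u₂, x₁, _, _, _) => (x₁, u₁, u₂))
        (fun (_, _, _, _, _, _, y₃) => y₃) =
    ∑ z, P.joint ch z * (Real.log ((fun (_, u₁, u₂, x₁, _, _, y₃) =>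
        P.destinationPosterior ch u₁ x₁ u₂ y₃) z) -
      Real.log ((fun (_, u₁, u₂, x₁, _, _, _) =>
        P.PU₁ u₁ * P.PX₁ u₁ x₁ * P.aux ch u₁ u₂) z)) := by
  rw [mutualInfo_eq_sum_log]
  refine P.sum_joint_congr ch ?_
  rintro ⟨s, u₁, u₂, x₁, x₂, y₂, y₃⟩ h
  have h1 := law_pos (P.joint_nonneg ch)
    (fun (_, u₁, u₂, x₁, _, _, y₃) => ((x₁, u₁, u₂), y₃)) h
  have h2 := law_pos (P.joint_nonneg ch) (fun (_, _, _, _, _, _, y₃) => y₃) h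
  have e1 := P.law_X₁_U₁_U₂ ch x₁ u₁ u₂
  dsimp only at h1 h2 ⊢
  rw [Input.destinationPosterior, Real.log_div h1.ne' h2.ne', e1]

theorem Input.condMutualInfo_state :
    condMutualInfo (P.joint ch) (fun (_, _, u₂, _, _, _, _) => u₂)
        (fun (s, _, _, _, _, _, _) => s) (fun (_, u₁, _, _, _, _, _) => u₁) =
    ∑ z, P.joint ch z * (Real.log ((fun (s, u₁, u₂, _, _, _, _) => P.PU₂ u₁ s u₂) z) -
      Real.log ((fun (_, u₁, u₂, _, _, _, _) => P.aux ch u₁ u₂) z)) := by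
  rw [condMutualInfo_eq_sum_log]
  refine P.sum_joint_congr ch ?_
  rintro ⟨s, u₁, u₂, x₁, x₂, y₂, y₃⟩ h
  obtain ⟨hQ, hU, -, hU₂⟩ := P.factors_pos ch h
  have ha := P.aux_pos ch hQ hU₂
  have e1 := P.law_U₂_S_U₁ ch u₂ s u₁
  have e2 := P.law_S_U₁ ch s u₁
  have e3 := P.law_U₂_U₁ ch u₂ u₁
  have e4 := P.law_U₁ ch u₁
  dsimp only
  rw [e1, e2, e3, e4, Real.log_mul hU₂.ne' (mul_pos hQ hU).ne', Real.log_mul ha.ne' hU.ne']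
  ring

/-- Gibbs' inequality, from `log x ≤ x - 1` applied to `aux / PU₂`. It keeps the exponent of `J`
nonnegative, as `ceil_exp_le` requires. -/
theorem Input.condMutualInfo_state_nonneg :
    0 ≤ condMutualInfo (P.joint ch) (fun (_, _, u₂, _, _, _, _) => u₂)
        (fun (s, _, _, _, _, _, _) => s) (fun (_, u₁, _, _, _, _, _) => u₁) := by
  rw [P.condMutualInfo_state ch]
  have h1 : ∑ z, P.joint ch z * (fun (s, u₁, u₂, _, _, _, _) =>
      P.aux ch u₁ u₂ / P.PU₂ u₁ s u₂) z ≤ 1 := by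
    rw [P.sum_joint_mul ch fun s u₁ u₂ _ => P.aux ch u₁ u₂ / P.PU₂ u₁ s u₂]
    calc _ ≤ ∑ s, ∑ u₁, ∑ u₂, ∑ x₁, ch.Q s * P.PU₁ u₁ * P.PX₁ u₁ x₁ * P.aux ch u₁ u₂ := by
          refine Finset.sum_le_sum fun s _ => Finset.sum_le_sum fun u₁ _ =>
            Finset.sum_le_sum fun u₂ _ => Finset.sum_le_sum fun x₁ _ => ?_
          rw [mul_assoc _ (P.PU₂ u₁ s u₂)]
          refine mul_le_mul_of_nonneg_left ?_ (mul_nonneg (mul_nonneg (ch.Q_mem.1 s)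
            (P.PU₁_mem.1 u₁)) ((P.PX₁_mem u₁).1 x₁))
          by_cases h : P.PU₂ u₁ s u₂ = 0
          · rw [h, zero_mul]; exact (P.aux_mem ch u₁).1 u₂
          · rw [mul_div_cancel₀ _ h]
      _ = 1 := by
          rw [Finset.sum_comm]
          simp only [← Finset.sum_mul, ← Finset.mul_sum, (P.PX₁_mem _).2, (P.aux_mem ch _).2,
            ch.Q_mem.2, P.PU₁_mem.2, mul_one, one_mul]
  have h2 : ∑ z, P.joint ch z * (1 - (fun (s, u₁, u₂, _, _, _, _) =>
      P.aux ch u₁ u₂ / P.PU₂ u₁ s u₂) z) ≤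
      ∑ z, P.joint ch z * (Real.log ((fun (s, u₁, u₂, _, _, _, _) => P.PU₂ u₁ s u₂) z) -
        Real.log ((fun (_, u₁, u₂, _, _, _, _) => P.aux ch u₁ u₂) z)) := by
    refine Finset.sum_le_sum fun z _ => ?_
    rcases (P.joint_nonneg ch z).eq_or_lt with h0 | h0
    · rw [← h0, zero_mul, zero_mul]
    refine mul_le_mul_of_nonneg_left ?_ h0.le
    obtain ⟨s, u₁, u₂, x₁, x₂, y₂, y₃⟩ := z
    obtain ⟨hQ, -, -, hU₂⟩ := P.factors_pos ch h0
    have ha := P.aux_pos ch hQ hU₂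
    have := Real.log_le_sub_one_of_pos (div_pos ha hU₂)
    rw [Real.log_div ha.ne' hU₂.ne'] at this
    dsimp only
    linarith
  simp only [mul_sub (P.joint ch _) 1, mul_one, Finset.sum_sub_distrib, (P.joint_mem ch).2] at h2
  linarith

end Marginals

/-! ### Memoryless powers and error exponents -/

section Powers

variable {X₁ X₂ S Y₂ Y₃ U₁ U₂ : Type*} [Fintype X₁] [Fintype X₂] [Fintype S]
  [Fintype Y₂] [Fintype Y₃] [Fintype U₁] [Fintype U₂]

theorem sum_prod_pi {ι : Type*} [Fintype ι] [DecidableEq ι] (f : ι → Y₂ × Y₃ → ℝ) :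
    ∑ y : (ι → Y₂) × (ι → Y₃), ∏ i, f i (y.1 i, y.2 i) = ∏ i, ∑ y, f i y := by
  rw [← sum_pi_prod]
  exact (Fintype.sum_equiv (Equiv.arrowProdEquivProdArrow ι (fun _ => Y₂) fun _ => Y₃) _ _
    fun _ => rfl).symm

/-- The channel of `m` memoryless uses with independent states. -/
def Channel.pow (ch : Channel X₁ X₂ S Y₂ Y₃) (m : ℕ) :
    Channel (Fin m → X₁) (Fin m → X₂) (Fin m → S) (Fin m → Y₂) (Fin m → Y₃) where
  Q s := ∏ k, ch.Q (s k)
  Q_mem := pi_mem_stdSimplex (fun _ => ch.Q) fun _ => ch.Q_mem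
  W x₁ x₂ s y := ∏ k, ch.W (x₁ k) (x₂ k) (s k) (y.1 k, y.2 k)
  W_mem x₁ x₂ s := by
    refine ⟨fun y => Finset.prod_nonneg fun k _ => (ch.W_mem _ _ _).1 _, ?_⟩
    rw [sum_prod_pi fun k => ch.W (x₁ k) (x₂ k) (s k)]
    exact Finset.prod_eq_one fun k _ => (ch.W_mem _ _ _).2

/-- Independent copies of an input distribution. -/
def Input.pow (P : Input X₁ X₂ S U₁ U₂) (m : ℕ) :
    Input (Fin m → X₁) (Fin m → X₂) (Fin m → S) (Fin m → U₁) (Fin m → U₂) where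
  PU₁ u₁ := ∏ k, P.PU₁ (u₁ k)
  PU₁_mem := pi_mem_stdSimplex (fun _ => P.PU₁) fun _ => P.PU₁_mem
  PX₁ u₁ x₁ := ∏ k, P.PX₁ (u₁ k) (x₁ k)
  PX₁_mem u₁ := pi_mem_stdSimplex (fun k => P.PX₁ (u₁ k)) fun _ => P.PX₁_mem _
  PU₂ u₁ s u₂ := ∏ k, P.PU₂ (u₁ k) (s k) (u₂ k)
  PU₂_mem u₁ s := pi_mem_stdSimplex (fun k => P.PU₂ (u₁ k) (s k)) fun _ => P.PU₂_mem _ _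
  PX₂ u₁ u₂ s x₂ := ∏ k, P.PX₂ (u₁ k) (u₂ k) (s k) (x₂ k)
  PX₂_mem u₁ u₂ s := pi_mem_stdSimplex (fun k => P.PX₂ (u₁ k) (u₂ k) (s k))
    fun _ => P.PX₂_mem _ _ _

variable (P : Input X₁ X₂ S U₁ U₂) (ch : Channel X₁ X₂ S Y₂ Y₃) (m : ℕ)

theorem Input.aux_pow (u₁ : Fin m → U₁) (u₂ : Fin m → U₂) :
    (P.pow m).aux (ch.pow m) u₁ u₂ = ∏ k, P.aux ch (u₁ k) (u₂ k) := by
  simp only [Input.aux, Input.pow, Channel.pow, ← Finset.prod_mul_distrib]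
  exact sum_pi_prod fun k s => ch.Q s * P.PU₂ (u₁ k) s (u₂ k)

theorem Input.sum_joint_pow
    (φ : (Fin m → S) × (Fin m → U₁) × (Fin m → U₂) × (Fin m → X₁) × (Fin m → X₂) ×
      (Fin m → Y₂) × (Fin m → Y₃) → ℝ) :
    ∑ z, (P.pow m).joint (ch.pow m) z * φ z =
      ∑ z : Fin m → S × U₁ × U₂ × X₁ × X₂ × Y₂ × Y₃, (∏ k, P.joint ch (z k)) *
        φ (fun k => (z k).1, fun k => (z k).2.1, fun k => (z k).2.2.1, fun k => (z k).2.2.2.1,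
          fun k => (z k).2.2.2.2.1, fun k => (z k).2.2.2.2.2.1, fun k => (z k).2.2.2.2.2.2) := by
  refine (Fintype.sum_equiv
    { toFun := fun z => (fun k => (z k).1, fun k => (z k).2.1, fun k => (z k).2.2.1,
        fun k => (z k).2.2.2.1, fun k => (z k).2.2.2.2.1, fun k => (z k).2.2.2.2.2.1,
        fun k => (z k).2.2.2.2.2.2)
      invFun := fun (s, u₁, u₂, x₁, x₂, y₂, y₃) k =>
        (s k, u₁ k, u₂ k, x₁ k, x₂ k, y₂ k, y₃ k)
      left_inv := fun _ => rfl
      right_inv := fun _ => rfl } _ _ fun z => ?_).symm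
  simp only [Input.joint, Input.pow, Channel.pow, Equiv.coe_fn_mk, ← Finset.prod_mul_distrib]

theorem sum_sum_sum_pi {α β γ : Type*} [Fintype α] [Fintype β] [Fintype γ]
    (F : (Fin m → α) → (Fin m → β) → (Fin m → γ) → ℝ) :
    ∑ a, ∑ b, ∑ c, F a b c = ∑ z : Fin m → α × β × γ,
      F (fun k => (z k).1) (fun k => (z k).2.1) (fun k => (z k).2.2) := by
  have h := Fintype.sum_equiv
    (⟨fun z => (fun k => (z k).1, fun k => (z k).2.1, fun k => (z k).2.2),
      fun v k => (v.1 k, v.2.1 k, v.2.2 k), fun _ => rfl, fun _ => rfl⟩ :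
      (Fin m → α × β × γ) ≃ (Fin m → α) × (Fin m → β) × (Fin m → γ))
    (fun z => F (fun k => (z k).1) (fun k => (z k).2.1) (fun k => (z k).2.2))
    (fun v => F v.1 v.2.1 v.2.2) fun _ => rfl
  rw [h, Fintype.sum_prod_type]
  exact Finset.sum_congr rfl fun a _ =>
    (Fintype.sum_prod_type fun v : (Fin m → β) × (Fin m → γ) => F a v.1 v.2).symm

/-- Change of measure: where the test is passed, `PX₁` is at most `exp (-a)` times the posterior,
whose total mass is at most one. -/
theorem Input.sum_PX₁_pow_ind_le (a : ℝ) (u₁ : Fin m → U₁) (s : Fin m → S) (y₂ : Fin m → Y₂) :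
    ∑ x₁, (P.pow m).PX₁ u₁ x₁ * ind (Real.exp a * ∏ k, P.PX₁ (u₁ k) (x₁ k) ≤
      ∏ k, P.relayPosterior ch (u₁ k) (x₁ k) (s k) (y₂ k)) ≤ Real.exp (-a) := by
  calc _ ≤ ∑ x₁ : Fin m → X₁, Real.exp (-a) *
        ∏ k, P.relayPosterior ch (u₁ k) (x₁ k) (s k) (y₂ k) := by
        refine Finset.sum_le_sum fun x₁ _ => ?_
        have h0 : 0 ≤ ∏ k, P.relayPosterior ch (u₁ k) (x₁ k) (s k) (y₂ k) :=
          Finset.prod_nonneg fun k _ => P.relayPosterior_nonneg ch _ _ _ _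
        by_cases h : Real.exp a * ∏ k, P.PX₁ (u₁ k) (x₁ k) ≤
            ∏ k, P.relayPosterior ch (u₁ k) (x₁ k) (s k) (y₂ k)
        · rw [ind_of_true h, mul_one, Real.exp_neg, ← div_eq_inv_mul,
            le_div_iff₀ (Real.exp_pos a), mul_comm]
          exact h
        · rw [ind_of_false h, mul_zero]; positivity
    _ ≤ Real.exp (-a) * 1 := by
        rw [← Finset.mul_sum, sum_pi_prod fun k x => P.relayPosterior ch (u₁ k) x (s k) (y₂ k)]
        refine mul_le_mul_of_nonneg_left (Finset.prod_le_one (fun k _ => ?_) fun k _ => ?_)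
          (Real.exp_pos _).le
        · exact Finset.sum_nonneg fun x _ => P.relayPosterior_nonneg ch _ _ _ _
        · exact P.sum_relayPosterior_le_one ch _ _ _
    _ = _ := mul_one _

theorem Input.sum_aux_pow_ind_le (a : ℝ) (y₃ : Fin m → Y₃) :
    ∑ u₁, (P.pow m).PU₁ u₁ * ∑ x₁, (P.pow m).PX₁ u₁ x₁ *
      ∑ u₂, (P.pow m).aux (ch.pow m) u₁ u₂ * ind (Real.exp a *
        ∏ k, (P.PU₁ (u₁ k) * P.PX₁ (u₁ k) (x₁ k) * P.aux ch (u₁ k) (u₂ k)) ≤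
      ∏ k, P.destinationPosterior ch (u₁ k) (x₁ k) (u₂ k) (y₃ k)) ≤ Real.exp (-a) := by
  simp only [Finset.mul_sum]
  calc _ ≤ ∑ u₁ : Fin m → U₁, ∑ x₁ : Fin m → X₁, ∑ u₂ : Fin m → U₂, Real.exp (-a) *
        ∏ k, P.destinationPosterior ch (u₁ k) (x₁ k) (u₂ k) (y₃ k) := by
        refine Finset.sum_le_sum fun u₁ _ => Finset.sum_le_sum fun x₁ _ =>
          Finset.sum_le_sum fun u₂ _ => ?_
        have h0 : 0 ≤ ∏ k, P.destinationPosterior ch (u₁ k) (x₁ k) (u₂ k) (y₃ k) :=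
          Finset.prod_nonneg fun k _ => P.destinationPosterior_nonneg ch _ _ _ _
        by_cases h : Real.exp a *
            ∏ k, (P.PU₁ (u₁ k) * P.PX₁ (u₁ k) (x₁ k) * P.aux ch (u₁ k) (u₂ k)) ≤
            ∏ k, P.destinationPosterior ch (u₁ k) (x₁ k) (u₂ k) (y₃ k)
        · rw [ind_of_true h, mul_one, Real.exp_neg, ← div_eq_inv_mul,
            le_div_iff₀ (Real.exp_pos a), P.aux_pow ch]
          simp only [Input.pow]
          rw [← mul_assoc, ← Finset.prod_mul_distrib, ← Finset.prod_mul_distrib, mul_comm]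
          exact h
        · rw [ind_of_false h, mul_zero, mul_zero, mul_zero]; positivity
    _ = Real.exp (-a) *
          ∏ k, ∑ v : U₁ × X₁ × U₂, P.destinationPosterior ch v.1 v.2.1 v.2.2 (y₃ k) := by
        rw [← sum_pi_prod fun k (v : U₁ × X₁ × U₂) =>
          P.destinationPosterior ch v.1 v.2.1 v.2.2 (y₃ k)]
        rw [sum_sum_sum_pi, ← Finset.mul_sum]
    _ ≤ Real.exp (-a) * 1 := by
        refine mul_le_mul_of_nonneg_left (Finset.prod_le_one (fun k _ => ?_) fun k _ => ?_)
          (Real.exp_pos _).le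
        · exact Finset.sum_nonneg fun x _ => P.destinationPosterior_nonneg ch _ _ _ _
        · simpa only [Fintype.sum_prod_type] using P.sum_destinationPosterior_le_one ch (y₃ k)
    _ = _ := mul_one _

theorem ceil_exp_le {x : ℝ} (hx : 0 ≤ x) : (⌈Real.exp x⌉₊ : ℝ) ≤ 2 * Real.exp x := by
  have h1 := Nat.ceil_lt_add_one (Real.exp_pos x).le
  have h2 := Real.one_le_exp hx
  linarith

theorem Input.exists_tail_relay {I δ : ℝ} (hδ : 0 < δ)
    (hI : condMutualInfo (P.joint ch) (fun (_, _, _, x₁, _, _, _) => x₁)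
      (fun (_, _, _, _, _, y₂, _) => y₂) (fun (s, u₁, _, _, _, _, _) => (s, u₁)) = I) :
    ∃ C : ℝ, ∀ m : ℕ, 0 < m → ∑ z, (P.pow m).joint (ch.pow m) z *
      (fun (s, u₁, _, x₁, _, y₂, _) => ind (¬Real.exp (m * (I - δ)) *
        ∏ k, P.PX₁ (u₁ k) (x₁ k) ≤ ∏ k, P.relayPosterior ch (u₁ k) (x₁ k) (s k) (y₂ k))) z ≤
      C / m := by
  rw [P.condMutualInfo_relay ch] at hI
  obtain ⟨C, hC⟩ := exists_sum_pi_ind_density_le (P.joint_mem ch)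
    (fun ⟨s, u₁, u₂, x₁, x₂, y₂, y₃⟩ h => (P.factors_pos ch h).2.2.1)
    (fun ⟨s, u₁, u₂, x₁, x₂, y₂, y₃⟩ h => P.relayPosterior_pos ch h) hI hδ
  exact ⟨C, fun m hm => (P.sum_joint_pow ch m _).trans_le (hC m hm)⟩

theorem Input.exists_tail_destination {I δ : ℝ} (hδ : 0 < δ)
    (hI : mutualInfo (P.joint ch) (fun (_, u₁, u₂, x₁, _, _, _) => (x₁, u₁, u₂))
        (fun (_, _, _, _, _, _, y₃) => y₃) = I) :
    ∃ C : ℝ, ∀ m : ℕ, 0 < m → ∑ z, (P.pow m).joint (ch.pow m) z *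
      (fun (_, u₁, u₂, x₁, _, _, y₃) => ind (¬Real.exp (m * (I - δ)) *
        ∏ k, (P.PU₁ (u₁ k) * P.PX₁ (u₁ k) (x₁ k) * P.aux ch (u₁ k) (u₂ k)) ≤
      ∏ k, P.destinationPosterior ch (u₁ k) (x₁ k) (u₂ k) (y₃ k))) z ≤ C / m := by
  rw [P.mutualInfo_destination ch] at hI
  obtain ⟨C, hC⟩ := exists_sum_pi_ind_density_le (P.joint_mem ch)
    (fun ⟨s, u₁, u₂, x₁, x₂, y₂, y₃⟩ h => by
      obtain ⟨hQ, hU, hX, hU₂⟩ := P.factors_pos ch h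
      exact mul_pos (mul_pos hU hX) (P.aux_pos ch hQ hU₂))
    (fun ⟨s, u₁, u₂, x₁, x₂, y₂, y₃⟩ h => P.destinationPosterior_pos ch h) hI hδ
  exact ⟨C, fun m hm => (P.sum_joint_pow ch m _).trans_le (hC m hm)⟩

/-- The density is taken as `aux / PU₂`, with mean `-I`, because covering needs an upper bound on
`PU₂` in terms of `aux`. -/
theorem Input.exists_tail_state {I δ : ℝ} (hδ : 0 < δ)
    (hI : condMutualInfo (P.joint ch) (fun (_, _, u₂, _, _, _, _) => u₂)
        (fun (s, _, _, _, _, _, _) => s) (fun (_, u₁, _, _, _, _, _) => u₁) = I) :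
    ∃ C : ℝ, ∀ m : ℕ, 0 < m → ∑ z, (P.pow m).joint (ch.pow m) z *
      (fun (s, u₁, u₂, _, _, _, _) => ind (¬Real.exp (m * (-I - δ)) *
        ∏ k, P.PU₂ (u₁ k) (s k) (u₂ k) ≤ ∏ k, P.aux ch (u₁ k) (u₂ k))) z ≤ C / m := by
  rw [P.condMutualInfo_state ch] at hI
  obtain ⟨C, hC⟩ := exists_sum_pi_ind_density_le (P.joint_mem ch)
    (f := fun (s, u₁, u₂, _, _, _, _) => P.PU₂ u₁ s u₂)
    (g := fun (_, u₁, u₂, _, _, _, _) => P.aux ch u₁ u₂) (I := -I)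
    (fun ⟨s, u₁, u₂, x₁, x₂, y₂, y₃⟩ h => (P.factors_pos ch h).2.2.2)
    (fun ⟨s, u₁, u₂, x₁, x₂, y₂, y₃⟩ h =>
      P.aux_pos ch (P.factors_pos ch h).1 (P.factors_pos ch h).2.2.2)
    (by
      rw [← hI, ← Finset.sum_neg_distrib]
      exact Finset.sum_congr rfl fun z _ => by ring) hδ
  exact ⟨C, fun m hm => (P.sum_joint_pow ch m _).trans_le (hC m hm)⟩

/-- The margin `4 * δ` is spent at the destination: `δ` for the test, `2 * δ` for the surplus of `J`
over the exponential of `m * I₃`, and `δ` for decay. The `6` is `2 + 4`, from rounding up `M` at the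
relay and `M` and `J` at the destination; `η` and `1 / η` come from soft covering. -/
theorem Input.exists_blockCode_pow_le [Nonempty X₂] {R δ : ℝ} (hR : 0 ≤ R) (hδ : 0 < δ)
    (hRδ : R + 4 * δ ≤ P.rate ch) : ∃ C : ℝ, ∀ m : ℕ, 0 < m → ∀ η : ℝ, 0 < η → ∃ M : ℕ,
      Real.exp (m * R) ≤ M ∧ ∃ c : BlockCode (Fin m → X₁) (Fin m → X₂) (Fin m → S) (Fin m → Y₂)
        (Fin m → Y₃) M, ∑ w', ∑ w, c.err (ch.pow m) w w' ≤
          M ^ 2 * (C / m + (6 + 1 / η) * Real.exp (-(m * δ)) + η) := by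
  set I₁ := condMutualInfo (P.joint ch) (fun (_, _, _, x₁, _, _, _) => x₁)
      (fun (_, _, _, _, _, y₂, _) => y₂) (fun (s, u₁, _, _, _, _, _) => (s, u₁)) with hI₁
  set I₂ := mutualInfo (P.joint ch) (fun (_, u₁, u₂, x₁, _, _, _) => (x₁, u₁, u₂))
        (fun (_, _, _, _, _, _, y₃) => y₃) with hI₂
  set I₃ := condMutualInfo (P.joint ch) (fun (_, _, u₂, _, _, _, _) => u₂)
        (fun (s, _, _, _, _, _, _) => s) (fun (_, u₁, _, _, _, _, _) => u₁) with hI₃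
  have hr : P.rate ch = min I₁ (I₂ - I₃) := rfl
  have hR₁ : R + 4 * δ ≤ I₁ := hRδ.trans (hr.trans_le (min_le_left _ _))
  have hR₂ : R + 4 * δ ≤ I₂ - I₃ := hRδ.trans (hr.trans_le (min_le_right _ _))
  have hI₃0 : 0 ≤ I₃ := P.condMutualInfo_state_nonneg ch
  obtain ⟨C₁, t₁⟩ := P.exists_tail_relay ch hδ hI₁.symm
  obtain ⟨C₂, t₂⟩ := P.exists_tail_destination ch hδ hI₂.symm
  obtain ⟨C₃, t₃⟩ := P.exists_tail_state ch hδ hI₃.symm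
  clear_value I₁ I₂ I₃
  refine ⟨C₁ + C₂ + C₃, fun m hm η hη => ?_⟩
  have hm' : (0 : ℝ) < m := by exact_mod_cast hm
  set M := ⌈Real.exp (m * R)⌉₊ with hM
  -- One `δ` allows for the deviation of the state density, which gives `κ` below; the other makes
  -- `κ / J` decay.
  set J := ⌈Real.exp (m * (I₃ + 2 * δ))⌉₊ with hJ
  have hMle : (M : ℝ) ≤ 2 * Real.exp (m * R) := ceil_exp_le (by positivity)
  have hJle : (J : ℝ) ≤ 2 * Real.exp (m * (I₃ + 2 * δ)) := ceil_exp_le (by positivity)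
  have hJge : Real.exp (m * (I₃ + 2 * δ)) ≤ J := Nat.le_ceil _
  have hM0 : 0 < M := Nat.ceil_pos.2 (Real.exp_pos _)
  have hJ0 : 0 < J := Nat.ceil_pos.2 (Real.exp_pos _)
  refine ⟨M, Nat.le_ceil _, ?_⟩
  obtain ⟨c, hc⟩ := exists_blockCode (P.pow m) (ch.pow m) hM0 hJ0
    (A₁ := fun u₁ x₁ s y₂ => Real.exp (m * (I₁ - δ)) * ∏ k, P.PX₁ (u₁ k) (x₁ k) ≤
      ∏ k, P.relayPosterior ch (u₁ k) (x₁ k) (s k) (y₂ k))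
    (A₂ := fun u₁ x₁ u₂ y₃ => Real.exp (m * (I₂ - δ)) *
        ∏ k, (P.PU₁ (u₁ k) * P.PX₁ (u₁ k) (x₁ k) * P.aux ch (u₁ k) (u₂ k)) ≤
      ∏ k, P.destinationPosterior ch (u₁ k) (x₁ k) (u₂ k) (y₃ k))
    (T := fun u₁ u₂ s => Real.exp (m * (-I₃ - δ)) * ∏ k, P.PU₂ (u₁ k) (s k) (u₂ k) ≤
      ∏ k, P.aux ch (u₁ k) (u₂ k))
    (a₁ := Real.exp (-(m * (I₁ - δ)))) (a₂ := Real.exp (-(m * (I₂ - δ))))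
    (κ := Real.exp (m * (I₃ + δ))) (δ := η)
    (Real.exp_pos _).le (Real.exp_pos _).le (Real.exp_pos _).le hη
    (P.sum_PX₁_pow_ind_le ch m _) (P.sum_aux_pow_ind_le ch m _)
    (by
      intro u₁ u₂ s h
      rw [P.aux_pow]
      have h1 := mul_le_mul_of_nonneg_left h (Real.exp_pos (m * (I₃ + δ))).le
      rw [← mul_assoc, ← Real.exp_add] at h1
      rw [show (m * (I₃ + δ) + m * (-I₃ - δ) : ℝ) = 0 by ring, Real.exp_zero, one_mul] at h1
      exact h1)
  refine ⟨c, hc.trans (mul_le_mul_of_nonneg_left ?_ (by positivity))⟩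
  have b₁ : M * Real.exp (-(m * (I₁ - δ))) ≤ 2 * Real.exp (-(m * δ)) := by
    refine (mul_le_mul_of_nonneg_right hMle (Real.exp_pos _).le).trans ?_
    rw [mul_assoc, ← Real.exp_add]
    gcongr
    nlinarith
  have b₂ : M * J * Real.exp (-(m * (I₂ - δ))) ≤ 4 * Real.exp (-(m * δ)) := by
    have h1 : (M * J : ℝ) ≤ (2 * Real.exp (m * R)) * (2 * Real.exp (m * (I₃ + 2 * δ))) := by
      gcongr
    refine (mul_le_mul_of_nonneg_right h1 (Real.exp_pos _).le).trans ?_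
    rw [show 2 * Real.exp (m * R) * (2 * Real.exp (m * (I₃ + 2 * δ))) *
      Real.exp (-(m * (I₂ - δ))) = 4 * (Real.exp (m * R) * Real.exp (m * (I₃ + 2 * δ)) *
      Real.exp (-(m * (I₂ - δ)))) by ring, ← Real.exp_add, ← Real.exp_add]
    gcongr
    nlinarith
  have b₃ : Real.exp (m * (I₃ + δ)) / (η * J) ≤ 1 / η * Real.exp (-(m * δ)) := by
    have h1 : Real.exp (m * (I₃ + δ)) = Real.exp (-(m * δ)) * Real.exp (m * (I₃ + 2 * δ)) := by
      rw [← Real.exp_add]; congr 1; ring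
    have hJ' : (0 : ℝ) < J := by exact_mod_cast hJ0
    rw [div_le_iff₀ (by positivity), h1]
    calc _ ≤ Real.exp (-(m * δ)) * J := by gcongr
      _ = _ := by field_simp
  have := add_le_add (add_le_add (add_le_add (t₁ m hm) (t₂ m hm)) (t₃ m hm))
    (add_le_add (add_le_add b₁ b₂) b₃)
  rw [add_div, add_div]
  linarith

end Powers

/-! ### Total mass of the block law and padding of codes -/

section Blocks

variable {X₁ X₂ S Y₂ Y₃ : Type*} [Fintype X₁] [Fintype X₂] [Fintype S]
  [Fintype Y₂] [Fintype Y₃]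

/-- A causal product of transition probabilities has total mass one. -/
theorem sum_causal_prod {Y : Type*} [Fintype Y] : ∀ {n : ℕ}
    (K : (i : Fin n) → (Fin (i : ℕ) → Y) → Y → ℝ) (_ : ∀ i h, ∑ a, K i h a = 1),
    ∑ y : Fin n → Y, ∏ i, K i (fun j => y (j.castLE i.isLt.le)) (y i) = 1
  | 0, K, hK => by simp
  | n + 1, K, hK => by
    -- By causality no earlier factor sees the last coordinate, so it is summed out first.
    rw [← (Fin.snocEquiv fun _ : Fin (n + 1) => Y).sum_comp, Fintype.sum_prod_type,
      Finset.sum_comm]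
    have h := sum_causal_prod (fun i : Fin n => K i.castSucc) fun i => hK i.castSucc
    rw [← h]
    refine Finset.sum_congr rfl fun y _ => ?_
    simp only [Fin.prod_univ_castSucc]
    have h1 : ∀ (a : Y) (i : Fin n), K i.castSucc (fun j => (Fin.snocEquiv fun _ => Y) (a, y)
        (j.castLE i.castSucc.isLt.le)) ((Fin.snocEquiv fun _ => Y) (a, y) i.castSucc) =
        K i.castSucc (fun j => y (j.castLE i.isLt.le)) (y i) := by
      intro a i
      have h2 : ∀ j : Fin (i.castSucc : ℕ), (Fin.snocEquiv fun _ => Y) (a, y)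
          (j.castLE i.castSucc.isLt.le) = y (j.castLE i.isLt.le) := fun j =>
        Fin.snoc_castSucc (α := fun _ => Y) a y (j.castLE i.isLt.le)
      have h3 : (Fin.snocEquiv fun _ => Y) (a, y) i.castSucc = y i :=
        Fin.snoc_castSucc (α := fun _ => Y) a y i
      simp only [h2, h3]
    have h4 : ∀ (a : Y), K (Fin.last n) (fun j => (Fin.snocEquiv fun _ => Y) (a, y)
        (j.castLE (Fin.last n).isLt.le)) ((Fin.snocEquiv fun _ => Y) (a, y) (Fin.last n)) =
        K (Fin.last n) y a := by
      intro a
      have h2 : ∀ j : Fin n, (Fin.snocEquiv fun _ => Y) (a, y)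
          (j.castLE (Fin.last n).isLt.le) = y j := fun j =>
        Fin.snoc_castSucc (α := fun _ => Y) a y j
      have h3 : (Fin.snocEquiv fun _ => Y) (a, y) (Fin.last n) = a :=
        Fin.snoc_last (α := fun _ => Y) a y
      exact congr_arg₂ (K (Fin.last n)) (funext h2) h3
    simp only [h1, h4]
    rw [← Finset.mul_sum, hK, mul_one]
    rfl

variable (ch : Channel X₁ X₂ S Y₂ Y₃)

theorem Channel.blockProb_nonneg {n M : ℕ} (c : Code X₁ X₂ S Y₂ Y₃ n M) (w : Fin M)
    (s : Fin n → S) (y : Fin n → Y₂ × Y₃) : 0 ≤ ch.blockProb c w s y :=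
  mul_nonneg (Finset.prod_nonneg fun _ _ => ch.Q_mem.1 _)
    (Finset.prod_nonneg fun _ _ => (ch.W_mem _ _ _).1 _)

/-- The law of a chain is compared with a product law only where no block fails; total mass one then
controls the complement. -/
theorem Channel.sum_blockProb {n M : ℕ} (c : Code X₁ X₂ S Y₂ Y₃ n M) (w : Fin M) :
    ∑ s, ∑ y, ch.blockProb c w s y = 1 := by
  unfold Channel.blockProb
  rw [← (pi_mem_stdSimplex (fun _ : Fin n => ch.Q) fun _ => ch.Q_mem).2]
  refine Finset.sum_congr rfl fun s _ => ?_
  rw [← Finset.mul_sum, sum_causal_prod (fun i h => ch.W (c.source w i)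
    (c.relay i s fun j => (h j).1) (s i)) fun i h => (ch.W_mem _ _ _).2, mul_one]

/-- A code for one more channel use that ignores the last use. -/
noncomputable def Code.extend {n M : ℕ} (c : Code X₁ X₂ S Y₂ Y₃ n M) (x₁ : X₁) (x₂ : X₂) :
    Code X₁ X₂ S Y₂ Y₃ (n + 1) M where
  source w := Fin.snoc (α := fun _ => X₁) (c.source w) x₁
  relay i s y := if h : (i : ℕ) < n then c.relay ⟨i, h⟩ (fun k => s k.castSucc) y else x₂
  decode y := c.decode fun k => y k.castSucc

theorem Channel.blockProb_extend {n M : ℕ} (c : Code X₁ X₂ S Y₂ Y₃ n M) (x₁ : X₁) (x₂ : X₂)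
    (w : Fin M) (s : Fin (n + 1) → S) (y : Fin (n + 1) → Y₂ × Y₃) :
    ch.blockProb (c.extend x₁ x₂) w s y =
      ch.blockProb c w (fun i => s i.castSucc) (fun i => y i.castSucc) *
        (ch.Q (s (Fin.last n)) * ch.W x₁ x₂ (s (Fin.last n)) (y (Fin.last n))) := by
  have h1 : ∀ i : Fin n, (c.extend x₁ x₂).source w i.castSucc = c.source w i := fun i =>
    Fin.snoc_castSucc (α := fun _ => X₁) _ _ _
  have h2 : (c.extend x₁ x₂).source w (Fin.last n) = x₁ := Fin.snoc_last (α := fun _ => X₁) _ _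
  have h3 : ∀ (i : Fin n) (z : Fin (i : ℕ) → Y₂), (c.extend x₁ x₂).relay i.castSucc s z =
      c.relay i (fun k => s k.castSucc) z := fun i z => by
    simp only [Code.extend, Fin.val_castSucc, i.isLt, dif_pos, Fin.eta]
  have h4 : ∀ z, (c.extend x₁ x₂).relay (Fin.last n) s z = x₂ := fun z => by
    simp [Code.extend]
  unfold Channel.blockProb
  rw [Fin.prod_univ_castSucc, Fin.prod_univ_castSucc, h2, h4]
  have h5 : ∀ i : Fin n, ch.W ((c.extend x₁ x₂).source w i.castSucc)
      ((c.extend x₁ x₂).relay i.castSucc s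
        fun j => (y (j.castLE i.castSucc.isLt.le)).1) (s i.castSucc) (y i.castSucc) =
      ch.W (c.source w i) (c.relay i (fun k => s k.castSucc)
        fun j => (y (j.castLE i.isLt.le).castSucc).1) (s i.castSucc) (y i.castSucc) := fun i => by
    rw [h1]
    exact congrArg (fun x => ch.W (c.source w i) x (s i.castSucc) (y i.castSucc)) (h3 i _)
  simp only [h5]
  ring

theorem sum_snoc {α : Type*} [Fintype α] {n : ℕ} (F : (Fin n → α) → α → ℝ) :
    ∑ f : Fin (n + 1) → α, F (fun i => f i.castSucc) (f (Fin.last n)) = ∑ f, ∑ a, F f a := by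
  rw [← (Fin.snocEquiv fun _ : Fin (n + 1) => α).sum_comp, Fintype.sum_prod_type,
    Finset.sum_comm]
  refine Finset.sum_congr rfl fun f _ => Finset.sum_congr rfl fun a _ => ?_
  simp [Fin.snocEquiv]

/-- The decoder ignores the last output and no earlier input depends on the last state, so both sum
out to one. -/
theorem Channel.errorProb_extend {n M : ℕ} (c : Code X₁ X₂ S Y₂ Y₃ n M) (x₁ : X₁) (x₂ : X₂) :
    ch.errorProb (c.extend x₁ x₂) = ch.errorProb c := by
  classical
  unfold Channel.errorProb
  congr 1
  refine Finset.sum_congr rfl fun w _ => ?_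
  simp only [ch.blockProb_extend]
  rw [sum_snoc fun s a => ∑ y : Fin (n + 1) → Y₂ × Y₃,
    if (c.extend x₁ x₂).decode (fun i => (y i).2) ≠ w then
      ch.blockProb c w s (fun i => y i.castSucc) *
        (ch.Q a * ch.W x₁ x₂ a (y (Fin.last n))) else 0]
  refine Finset.sum_congr rfl fun s _ => ?_
  have h : ∀ a, (∑ y : Fin (n + 1) → Y₂ × Y₃,
      if (c.extend x₁ x₂).decode (fun i => (y i).2) ≠ w then
        ch.blockProb c w s (fun i => y i.castSucc) *
          (ch.Q a * ch.W x₁ x₂ a (y (Fin.last n))) else 0) =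
      ch.Q a * ∑ y, if c.decode (fun i => (y i).2) ≠ w then ch.blockProb c w s y else 0 := by
    intro a
    refine (sum_snoc fun (y : Fin n → Y₂ × Y₃) (b : Y₂ × Y₃) =>
      if c.decode (fun i => (y i).2) ≠ w then
        ch.blockProb c w s y * (ch.Q a * ch.W x₁ x₂ a b) else 0).trans ?_
    rw [Finset.mul_sum]
    refine Finset.sum_congr rfl fun y _ => ?_
    split_ifs
    · rw [← Finset.mul_sum, ← Finset.mul_sum, (ch.W_mem _ _ _).2]; ring
    · simp
  simp only [h]
  rw [← Finset.sum_mul, ch.Q_mem.2, one_mul]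

theorem Channel.exists_code_add [Nonempty X₁] [Nonempty X₂] {n M : ℕ}
    (c : Code X₁ X₂ S Y₂ Y₃ n M) (r : ℕ) :
    ∃ c' : Code X₁ X₂ S Y₂ Y₃ (n + r) M, ch.errorProb c' = ch.errorProb c := by
  induction r with
  | zero => exact ⟨c, rfl⟩
  | succ r ih =>
    obtain ⟨c', h⟩ := ih
    exact ⟨c'.extend (Classical.arbitrary X₁) (Classical.arbitrary X₂),
      (ch.errorProb_extend c' _ _).trans h⟩

end Blocks

/-! ### Block Markov chains and backward decoding -/

section Chain

variable {X₁ X₂ S Y₂ Y₃ : Type*} {m M B : ℕ}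

/-- Cutting sequences of states and outputs into `B` blocks of length `m`. -/
def cut : (Fin (B * m) → S) × (Fin (B * m) → Y₂ × Y₃) ≃
    (Fin B → (Fin m → S) × (Fin m → Y₂) × (Fin m → Y₃)) where
  toFun σ b := (fun k => σ.1 (finProdFinEquiv (b, k)), fun k => (σ.2 (finProdFinEquiv (b, k))).1,
    fun k => (σ.2 (finProdFinEquiv (b, k))).2)
  invFun τ := (fun i => (τ (finProdFinEquiv.symm i).1).1 (finProdFinEquiv.symm i).2,
    fun i => ((τ (finProdFinEquiv.symm i).1).2.1 (finProdFinEquiv.symm i).2,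
      (τ (finProdFinEquiv.symm i).1).2.2 (finProdFinEquiv.symm i).2))
  left_inv σ := by
    refine Prod.ext (funext fun i => ?_) (funext fun i => ?_)
    · exact congrArg σ.1 (finProdFinEquiv.apply_symm_apply i)
    · exact congrArg σ.2 (finProdFinEquiv.apply_symm_apply i)
  right_inv τ := by
    funext b
    simp only [Equiv.symm_apply_apply]

/-- The successive estimates of the messages at the relay. -/
def relayEstimate (c : BlockCode (Fin m → X₁) (Fin m → X₂) (Fin m → S) (Fin m → Y₂)
    (Fin m → Y₃) M) (w₀ : Fin M) (s : Fin B → Fin m → S) (y : ℕ → Y₂) : ℕ → Fin M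
  | 0 => w₀
  | b + 1 => if h : b < B then
      c.relayDecode (relayEstimate c w₀ s y b) (s ⟨b, h⟩) (fun k => y (k + m * b)) else w₀

/-- Extension of a finite sequence to all natural indices. -/
noncomputable def extendSeq [Nonempty Y₂] {n : ℕ} (y : Fin n → Y₂) (j : ℕ) : Y₂ :=
  if h : j < n then y ⟨j, h⟩ else Classical.arbitrary Y₂

/-- The hypothesis speaks of the decoder when it is given the true previous message; induction shows
that its own estimates then stay on the true path. The estimate with index `b` is the message resent
in block `b`, hence the start `v 0`. -/
theorem relayEstimate_eq (c : BlockCode (Fin m → X₁) (Fin m → X₂) (Fin m → S) (Fin m → Y₂)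
    (Fin m → Y₃) M) (s : Fin B → Fin m → S) (y : ℕ → Y₂) (v : Fin (B + 1) → Fin M) {a : ℕ}
    (ha : a ≤ B) (h : ∀ b (hb : b < a), c.relayDecode (v ⟨b, by omega⟩) (s ⟨b, by omega⟩)
      (fun k => y (k + m * b)) = v ⟨b + 1, by omega⟩) :
    ∀ b (hb : b ≤ a), relayEstimate c (v 0) s y b = v ⟨b, by omega⟩
  | 0, _ => rfl
  | b + 1, hb => by
    rw [relayEstimate, dif_pos (by omega), relayEstimate_eq c s y v ha h b (by omega)]
    exact h b (by omega)

/-- The messages of all blocks from the two known ones at the ends and the others. -/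
def path {B' : ℕ} (w₀ w₁ : Fin M) (u : Fin B' → Fin M) : Fin (B' + 1 + 1) → Fin M :=
  Fin.cons (α := fun _ => Fin M) w₀ (Fin.snoc (α := fun _ => Fin M) u w₁)

theorem path_injective {B' : ℕ} (w₀ w₁ : Fin M) :
    Function.Injective (path w₀ w₁ : (Fin B' → Fin M) → _) := fun u u' h => by
  have h1 := Fin.cons_right_injective (α := fun _ => Fin M) w₀ h
  exact Fin.snoc_left_injective (α := fun _ => Fin M) w₁ h1

theorem path_last {B' : ℕ} (w₀ w₁ : Fin M) (u : Fin B' → Fin M) :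
    path w₀ w₁ u (Fin.last (B' + 1)) = w₁ := by
  unfold path
  rw [← Fin.succ_last, Fin.cons_succ, Fin.snoc_last]

/-- The messages are determined by the last one and by backward decoding. -/
theorem eq_of_backward {v v' : Fin (B + 1) → Fin M} {g : Fin B → Fin M → Fin M}
    (hlast : v (Fin.last B) = v' (Fin.last B)) (h : ∀ b, g b (v b.succ) = v b.castSucc)
    (hv : ∀ b, g b (v' b.succ) = v' b.castSucc) : v = v' := by
  funext b
  induction b using Fin.reverseInduction with
  | last => exact hlast
  | cast b ih => rw [← h, ← hv, ih]

/-- Block Markov coding: the block code is used in `B' + 1` blocks, each of which carries a new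
message and resends the previous one. -/
noncomputable def chainCode [Nonempty Y₂] {B' : ℕ}
    (c : BlockCode (Fin m → X₁) (Fin m → X₂) (Fin m → S) (Fin m → Y₂) (Fin m → Y₃) M)
    (w₀ w₁ : Fin M) : Code X₁ X₂ S Y₂ Y₃ ((B' + 1) * m) (M ^ B') where
  source μ i := c.source (path w₀ w₁ (finFunctionFinEquiv.symm μ) (finProdFinEquiv.symm i).1.succ)
    (path w₀ w₁ (finFunctionFinEquiv.symm μ) (finProdFinEquiv.symm i).1.castSucc)
    (finProdFinEquiv.symm i).2
  relay i s y := c.relay (relayEstimate c w₀ (fun b k => s (finProdFinEquiv (b, k))) (extendSeq y)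
      (finProdFinEquiv.symm i).1)
    (fun k => s (finProdFinEquiv ((finProdFinEquiv.symm i).1, k))) (finProdFinEquiv.symm i).2
  decode y := finFunctionFinEquiv (@Classical.epsilon _ ⟨fun _ => w₀⟩ fun u : Fin B' → Fin M =>
    ∀ b : Fin (B' + 1), c.decode (path w₀ w₁ u b.succ) (fun k => y (finProdFinEquiv (b, k))) =
      path w₀ w₁ u b.castSucc)

/-- The distribution of states and outputs in one block when the relay knows `w'`. -/
noncomputable def BlockCode.outputProb {X₁ X₂ S Y₂ Y₃ : Type*} [Fintype X₁] [Fintype X₂]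
    [Fintype S] [Fintype Y₂] [Fintype Y₃] (c : BlockCode X₁ X₂ S Y₂ Y₃ M)
    (ch : Channel X₁ X₂ S Y₂ Y₃) (w w' : Fin M) (t : S × Y₂ × Y₃) : ℝ :=
  ch.Q t.1 * ch.W (c.source w w') (c.relay w' t.1) t.1 t.2

theorem BlockCode.outputProb_mem {X₁ X₂ S Y₂ Y₃ : Type*} [Fintype X₁] [Fintype X₂]
    [Fintype S] [Fintype Y₂] [Fintype Y₃] (c : BlockCode X₁ X₂ S Y₂ Y₃ M)
    (ch : Channel X₁ X₂ S Y₂ Y₃) (w w' : Fin M) :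
    c.outputProb ch w w' ∈ stdSimplex ℝ (S × Y₂ × Y₃) := by
  refine ⟨fun t => mul_nonneg (ch.Q_mem.1 _) ((ch.W_mem _ _ _).1 _), ?_⟩
  simp only [BlockCode.outputProb, Fintype.sum_prod_type (α₁ := S), ← Finset.mul_sum,
    (ch.W_mem _ _ _).2, mul_one, ch.Q_mem.2]

theorem BlockCode.sum_outputProb_fails {X₁ X₂ S Y₂ Y₃ : Type*} [Fintype X₁] [Fintype X₂]
    [Fintype S] [Fintype Y₂] [Fintype Y₃] (c : BlockCode X₁ X₂ S Y₂ Y₃ M)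
    (ch : Channel X₁ X₂ S Y₂ Y₃) (w w' : Fin M) :
    ∑ t, c.outputProb ch w w' t * ind (c.Fails w w' t.1 t.2) = c.err ch w w' := by
  simp only [BlockCode.outputProb, BlockCode.err, Fintype.sum_prod_type (α₁ := S),
    Finset.mul_sum, mul_assoc]

/-- A distribution that agrees with a product distribution where no coordinate is bad gives
the complement no more than the sum of the probabilities of bad coordinates. -/
theorem sum_ind_not_le {A ι τ : Type*} [Fintype A] [Fintype ι] [DecidableEq ι] [Fintype τ]
    (e : A ≃ (ι → τ)) {p : A → ℝ} (hp : ∑ a, p a = 1) {G : ι → τ → ℝ}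
    (hG : ∀ b, G b ∈ stdSimplex ℝ τ) {Bad : ι → τ → Prop}
    (hpG : ∀ a, (∀ b, ¬Bad b (e a b)) → p a = ∏ b, G b (e a b)) :
    ∑ a, p a * ind (¬∀ b, ¬Bad b (e a b)) ≤ ∑ b, ∑ t, G b t * ind (Bad b t) := by
  have hG1 := pi_mem_stdSimplex G hG
  -- The two laws may differ on the bad event. Passing to the complement twice moves its mass from
  -- `p` to the product law, where the union bound factorises.
  calc ∑ a, p a * ind (¬∀ b, ¬Bad b (e a b)) = 1 - ∑ a, p a * ind (∀ b, ¬Bad b (e a b)) := by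
        rw [eq_sub_iff_add_eq, ← Finset.sum_add_distrib, ← hp]
        refine Finset.sum_congr rfl fun a _ => ?_
        rw [← mul_add, add_comm, ind_add_ind_not, mul_one]
    _ = 1 - ∑ a, (∏ b, G b (e a b)) * ind (∀ b, ¬Bad b (e a b)) := by
        congr 1
        refine Finset.sum_congr rfl fun a _ => ?_
        by_cases h : ∀ b, ¬Bad b (e a b)
        · rw [hpG a h]
        · rw [ind_of_false h, mul_zero, mul_zero]
    _ = 1 - ∑ f : ι → τ, (∏ b, G b (f b)) * ind (∀ b, ¬Bad b (f b)) := by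
        rw [← e.sum_comp fun f : ι → τ => (∏ b, G b (f b)) * ind (∀ b, ¬Bad b (f b))]
    _ = ∑ f : ι → τ, (∏ b, G b (f b)) * ind (¬∀ b, ¬Bad b (f b)) := by
        rw [sub_eq_iff_eq_add, ← Finset.sum_add_distrib, ← hG1.2]
        refine Finset.sum_congr rfl fun f _ => ?_
        rw [← mul_add, add_comm, ind_add_ind_not, mul_one]
    _ ≤ ∑ f : ι → τ, (∏ b, G b (f b)) * ∑ b, ind (Bad b (f b)) := by
        refine Finset.sum_le_sum fun f _ => mul_le_mul_of_nonneg_left ?_ (hG1.1 f)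
        by_cases h : ∀ b, ¬Bad b (f b)
        · rw [ind_of_false (not_not.2 h)]
          exact Finset.sum_nonneg fun _ _ => ind_nonneg _
        · rw [ind_of_true h]
          push Not at h
          obtain ⟨b, hb⟩ := h
          rw [← ind_of_true hb]
          exact Finset.single_le_sum (f := fun b => ind (Bad b (f b)))
            (fun _ _ => ind_nonneg _) (Finset.mem_univ b)
    _ = _ := by
        simp only [Finset.mul_sum]
        rw [Finset.sum_comm]
        exact Finset.sum_congr rfl fun b _ =>
          sum_pi_eval G (fun b => (hG b).2) b (fun t => ind (Bad b t))

variable [Nonempty Y₂] {B' : ℕ}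
  (c : BlockCode (Fin m → X₁) (Fin m → X₂) (Fin m → S) (Fin m → Y₂) (Fin m → Y₃) M)
  (w₀ w₁ : Fin M)

/-- No block fails. -/
def BlockCode.Good (v : Fin (B + 1) → Fin M)
    (τ : Fin B → (Fin m → S) × (Fin m → Y₂) × (Fin m → Y₃)) : Prop :=
  ∀ b : Fin B, ¬c.Fails (v b.succ) (v b.castSucc) (τ b).1 (τ b).2

/-- All candidate paths end in `w₁`. A candidate consistent with every block decision is thus
determined backwards from there, and where no block fails the true path is consistent. -/
theorem chainCode_decode (u : Fin B' → Fin M)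
    (σ : (Fin ((B' + 1) * m) → S) × (Fin ((B' + 1) * m) → Y₂ × Y₃))
    (h : c.Good (path w₀ w₁ u) (cut σ)) :
    (chainCode c w₀ w₁).decode (fun i => (σ.2 i).2) = finFunctionFinEquiv u := by
  unfold chainCode
  dsimp only
  congr 1
  have hg : ∀ b : Fin (B' + 1), c.decode (path w₀ w₁ u b.succ) (cut σ b).2.2 =
      path w₀ w₁ u b.castSucc := fun b => by
    have := h b
    simp only [BlockCode.Fails, not_or, not_not] at this
    exact this.2
  refine @epsilon_eq_of_unique _ ⟨fun _ => w₀⟩ _ u hg fun u' hne hu' => hne ?_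
  refine path_injective w₀ w₁ (eq_of_backward (g := fun b w => c.decode w (cut σ b).2.2) ?_ hu' hg)
  rw [path_last, path_last]

variable [Fintype X₁] [Fintype X₂] [Fintype S] [Fintype Y₂] [Fintype Y₃]
  (ch : Channel X₁ X₂ S Y₂ Y₃)

/-- Where no block fails, the relay's estimates are the true messages, so it acts in each block as
if it had been told the previous one, and the probability factorises over blocks. -/
theorem chainCode_blockProb (u : Fin B' → Fin M)
    (σ : (Fin ((B' + 1) * m) → S) × (Fin ((B' + 1) * m) → Y₂ × Y₃))
    (h : c.Good (path w₀ w₁ u) (cut σ)) :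
    ch.blockProb (chainCode c w₀ w₁) (finFunctionFinEquiv u) σ.1 σ.2 =
      ∏ b, c.outputProb (ch.pow m) (path w₀ w₁ u b.succ) (path w₀ w₁ u b.castSucc) (cut σ b) := by
  have hrel : ∀ (b : Fin (B' + 1)) (k : Fin m),
      (chainCode c w₀ w₁ (B' := B')).relay (finProdFinEquiv (b, k)) σ.1
        (fun j => (σ.2 (j.castLE (finProdFinEquiv (b, k)).isLt.le)).1) =
      c.relay (path w₀ w₁ u b.castSucc) (cut σ b).1 k := by
    intro b k
    simp only [chainCode, Equiv.symm_apply_apply]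
    have hest := relayEstimate_eq c (fun b k => σ.1 (finProdFinEquiv (b, k)))
      (extendSeq fun j : Fin ((finProdFinEquiv (b, k) : Fin ((B' + 1) * m)) : ℕ) =>
        (σ.2 (j.castLE (finProdFinEquiv (b, k)).isLt.le)).1) (path w₀ w₁ u) b.isLt.le
      (fun a ha => ?_) b le_rfl
    · exact congrArg (fun w => c.relay w (cut σ b).1 k) hest
    · have hb := b.isLt
      have hga := h ⟨a, by omega⟩
      simp only [BlockCode.Fails, not_or, not_not] at hga
      refine Eq.trans ?_ hga.1
      congr 1
      funext l
      -- Every output of a block `a < b` precedes each time in block `b`; so the estimate is causal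
      -- and the default value of `extendSeq` is not read.
      have hl : (l : ℕ) + m * a < (finProdFinEquiv (b, k) : Fin ((B' + 1) * m)) := by
        rw [finProdFinEquiv_apply_val]
        have h1 : m * (a + 1) ≤ m * b := Nat.mul_le_mul_left m ha
        have h2 := l.isLt
        rw [Nat.mul_add] at h1
        simp only
        omega
      rw [extendSeq, dif_pos hl]
      rfl
  unfold Channel.blockProb
  rw [← finProdFinEquiv.prod_comp, ← finProdFinEquiv.prod_comp, Fintype.prod_prod_type,
    Fintype.prod_prod_type, ← Finset.prod_mul_distrib]
  refine Finset.prod_congr rfl fun b _ => ?_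
  unfold BlockCode.outputProb
  congr 1
  refine Finset.prod_congr rfl fun k _ => ?_
  rw [hrel]
  simp only [chainCode, Equiv.symm_apply_apply]
  rfl

theorem chainCode_error_le (u : Fin B' → Fin M) :
    (∑ s, ∑ y, if (chainCode c w₀ w₁).decode (fun i => (y i).2) ≠ finFunctionFinEquiv u then
      ch.blockProb (chainCode c w₀ w₁) (finFunctionFinEquiv u) s y else 0) ≤
      ∑ b : Fin (B' + 1), c.err (ch.pow m) (path w₀ w₁ u b.succ) (path w₀ w₁ u b.castSucc) := by
  have hmain := sum_ind_not_le (cut (S := S) (Y₂ := Y₂) (Y₃ := Y₃) (m := m) (B := B' + 1))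
    (p := fun σ => ch.blockProb (chainCode c w₀ w₁) (finFunctionFinEquiv u) σ.1 σ.2)
    (by rw [Fintype.sum_prod_type]; exact ch.sum_blockProb _ _)
    (fun b => c.outputProb_mem (ch.pow m) (path w₀ w₁ u b.succ) (path w₀ w₁ u b.castSucc))
    (Bad := fun b t => c.Fails (path w₀ w₁ u b.succ) (path w₀ w₁ u b.castSucc) t.1 t.2)
    (fun σ h => chainCode_blockProb c w₀ w₁ ch u σ h)
  simp only [c.sum_outputProb_fails] at hmain
  refine le_trans ?_ hmain
  rw [Fintype.sum_prod_type]
  refine Finset.sum_le_sum fun s _ => Finset.sum_le_sum fun y _ => ?_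
  split_ifs with h
  · have hbad : ¬c.Good (path w₀ w₁ u) (cut (s, y)) := fun hg =>
      h (chainCode_decode c w₀ w₁ u (s, y) hg)
    exact (mul_one _).symm.trans_le (mul_le_mul_of_nonneg_left (ind_of_true hbad).ge
      (ch.blockProb_nonneg _ _ _ _))
  · exact mul_nonneg (ch.blockProb_nonneg _ _ _ _) (ind_nonneg _)

theorem sum_path {B' : ℕ} (F : (Fin (B' + 1 + 1) → Fin M) → ℝ) :
    ∑ w₀, ∑ w₁, ∑ u, F (path w₀ w₁ u) = ∑ v, F v := by
  rw [← (Fin.consEquiv fun _ : Fin (B' + 1 + 1) => Fin M).sum_comp, Fintype.sum_prod_type]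
  refine Finset.sum_congr rfl fun w₀ _ => ?_
  rw [← (Fin.snocEquiv fun _ : Fin (B' + 1) => Fin M).sum_comp, Fintype.sum_prod_type]
  rfl

/-- Block Markov coding turns a block code with small average error into a code. -/
theorem exists_code_of_blockCode (hM : 0 < M) {ε : ℝ}
    (hc : ∑ w', ∑ w, c.err (ch.pow m) w w' ≤ M ^ 2 * ε) (B' : ℕ) :
    ∃ c' : Code X₁ X₂ S Y₂ Y₃ ((B' + 1) * m) (M ^ B'),
      ch.errorProb c' ≤ (B' + 1) * ε := by
  have hM' : (0 : ℝ) < M := by exact_mod_cast hM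
  have hunif : (fun _ => 1 / (M : ℝ)) ∈ stdSimplex ℝ (Fin M) := by
    refine ⟨fun _ => by positivity, ?_⟩
    simp; field_simp
  let F : (Fin (B' + 1 + 1) → Fin M) → ℝ := fun v =>
    ∑ b : Fin (B' + 1), c.err (ch.pow m) (v b.succ) (v b.castSucc)
  -- With all messages uniform, the ends included, each consecutive pair is uniform on pairs, so the
  -- average in `hc` bounds every block.
  have hF : ∑ v, (∏ _b : Fin (B' + 1 + 1), 1 / (M : ℝ)) * F v ≤ (B' + 1) * ε := by
    simp only [F, Finset.mul_sum]
    rw [Finset.sum_comm]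
    calc _ ≤ ∑ b : Fin (B' + 1), ε := by
          refine Finset.sum_le_sum fun b _ => ?_
          rw [sum_pi_eval_two (fun _ _ => 1 / (M : ℝ)) (fun _ => hunif.2)
            (Fin.castSucc_lt_succ (i := b)).ne fun w' w => c.err (ch.pow m) w w']
          simp only [← Finset.mul_sum]
          calc _ ≤ 1 / (M : ℝ) * (1 / M) * (M ^ 2 * ε) := by gcongr
            _ = ε := by field_simp
      _ = _ := by simp
  rw [← sum_path fun v => (∏ _b : Fin (B' + 1 + 1), 1 / (M : ℝ)) * F v] at hF
  have hF2 : ∑ w : Fin M × Fin M, (1 / (M : ℝ) * (1 / M)) *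
      (∑ u, F (path w.1 w.2 u) / M ^ B') ≤ (B' + 1) * ε := by
    refine le_trans (le_of_eq ?_) hF
    rw [Fintype.sum_prod_type]
    refine Finset.sum_congr rfl fun w₀ _ => Finset.sum_congr rfl fun w₁ _ => ?_
    rw [Finset.mul_sum]
    refine Finset.sum_congr rfl fun u _ => ?_
    rw [Finset.prod_const, Finset.card_univ, Fintype.card_fin, one_div_pow]
    field_simp
    ring
  obtain ⟨⟨w₀, w₁⟩, hw⟩ := exists_le_of_sum_mul_le ⟨fun _ => by positivity, by
    simp; field_simp⟩ hF2
  refine ⟨chainCode c w₀ w₁, le_trans ?_ hw⟩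
  unfold Channel.errorProb
  rw [← Finset.sum_div, ← finFunctionFinEquiv.sum_comp]
  push_cast
  gcongr with u
  exact chainCode_error_le c w₀ w₁ ch u

end Chain

/-! ### Achievability of every rate below the bound -/

section Achievability

variable {X₁ X₂ S Y₂ Y₃ U₁ U₂ : Type*} [Fintype X₁] [Fintype X₂] [Fintype S]
  [Fintype Y₂] [Fintype Y₃] [Fintype U₁] [Fintype U₂]

theorem nonempty_of_mem_stdSimplex {α : Type*} [Fintype α] {p : α → ℝ}
    (hp : p ∈ stdSimplex ℝ α) : Nonempty α := by
  by_contra h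
  rw [not_nonempty_iff] at h
  have := hp.2
  simp at this

theorem Channel.nonempty_state (ch : Channel X₁ X₂ S Y₂ Y₃) : Nonempty S :=
  nonempty_of_mem_stdSimplex ch.Q_mem

theorem Channel.nonempty_relay_output [Nonempty X₁] [Nonempty X₂]
    (ch : Channel X₁ X₂ S Y₂ Y₃) : Nonempty Y₂ := by
  have := ch.nonempty_state
  have := nonempty_of_mem_stdSimplex
    (ch.W_mem (Classical.arbitrary X₁) (Classical.arbitrary X₂) (Classical.arbitrary S))
  exact this.map Prod.fst

variable (P : Input X₁ X₂ S U₁ U₂) (ch : Channel X₁ X₂ S Y₂ Y₃)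

theorem Input.exists_blockCode_pow [Nonempty X₂] {R : ℝ} (hR : 0 ≤ R) (hRP : R < P.rate ch)
    {ε : ℝ} (hε : 0 < ε) : ∃ m₀ : ℕ, ∀ m : ℕ, m₀ ≤ m → ∃ M : ℕ, Real.exp (m * R) ≤ M ∧
      ∃ c : BlockCode (Fin m → X₁) (Fin m → X₂) (Fin m → S) (Fin m → Y₂) (Fin m → Y₃) M,
        ∑ w', ∑ w, c.err (ch.pow m) w w' ≤ M ^ 2 * ε := by
  set δ := (P.rate ch - R) / 4 with hδ
  have hδ0 : 0 < δ := by rw [hδ]; linarith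
  obtain ⟨C, hC⟩ := P.exists_blockCode_pow_le ch hR hδ0 (by rw [hδ]; linarith)
  have hlim : Filter.Tendsto (fun m : ℕ => C / (m : ℝ) +
      (6 + 1 / (ε / 2)) * Real.exp (-(m * δ))) Filter.atTop (nhds (0 + (6 + 1 / (ε / 2)) * 0)) := by
    refine (tendsto_const_div_atTop_nhds_zero_nat C).add (Filter.Tendsto.const_mul _ ?_)
    exact Real.tendsto_exp_neg_atTop_nhds_zero.comp
      (tendsto_natCast_atTop_atTop.atTop_mul_const hδ0)
  rw [mul_zero, add_zero] at hlim
  obtain ⟨m₀, hm₀⟩ := Filter.eventually_atTop.1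
    ((hlim.eventually_lt_const (half_pos hε)).and (Filter.eventually_gt_atTop 0))
  refine ⟨m₀, fun m hm => ?_⟩
  obtain ⟨h1, h2⟩ := hm₀ m hm
  obtain ⟨M, hM, c, hc⟩ := hC m h2 (ε / 2) (half_pos hε)
  refine ⟨M, hM, c, hc.trans (mul_le_mul_of_nonneg_left ?_ (by positivity))⟩
  linarith

theorem Channel.achievable_of_nonpos [Nonempty X₁] [Nonempty X₂] {R : ℝ} (hR : R ≤ 0) :
    ch.Achievable R := by
  intro ε hε
  refine ⟨0, fun n _ => ⟨1, ⟨fun _ _ => Classical.arbitrary X₁,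
    fun _ _ _ => Classical.arbitrary X₂, fun _ => 0⟩, ?_, ?_⟩⟩
  · rw [Nat.cast_one, Real.exp_le_one_iff]
    exact mul_nonpos_of_nonneg_of_nonpos n.cast_nonneg hR
  · unfold Channel.errorProb
    refine le_trans (le_of_eq ?_) hε.le
    rw [Finset.sum_eq_zero, zero_div]
    intro w _
    refine Finset.sum_eq_zero fun s _ => Finset.sum_eq_zero fun y _ => ?_
    rw [if_neg (not_not.2 (Subsingleton.elim _ _))]

/-- Every rate below the rate of an input distribution is achievable. -/
theorem Input.achievable_of_lt_rate [Nonempty X₁] [Nonempty X₂] {R : ℝ} (hR : R < P.rate ch) :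
    ch.Achievable R := by
  rcases le_or_gt R 0 with h0 | h0
  · exact ch.achievable_of_nonpos h0
  intro ε hε
  have := ch.nonempty_relay_output
  obtain ⟨R', hRR', hR'⟩ := exists_between hR
  -- A chain of `B + 1` blocks carries only `B` messages; for this `B` the rate `R'` per block makes
  -- up for the loss.
  obtain ⟨B, hB⟩ := exists_nat_gt (R / (R' - R))
  have hB' : (B + 1) * R < B * R' := by
    rw [div_lt_iff₀ (by linarith)] at hB
    linarith
  have hε' : 0 < ε / (B + 1) := by positivity
  obtain ⟨m₀, hm₀⟩ := P.exists_blockCode_pow ch (h0.trans hRR').le hR' hε'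
  -- From this block length on, the surplus in the exponent exceeds `(B + 1) * R`, enough for the at
  -- most `B + 1` padding uses.
  obtain ⟨m₁, hm₁⟩ := exists_nat_gt ((B + 1) * R / (B * R' - (B + 1) * R))
  rw [div_lt_iff₀ (by linarith)] at hm₁
  refine ⟨(B + 1) * max m₀ m₁, fun n hn => ?_⟩
  obtain ⟨m, r, hm, hr, rfl⟩ : ∃ m r, max m₀ m₁ ≤ m ∧ r ≤ B + 1 ∧ (B + 1) * m + r = n :=
    ⟨n / (B + 1), n % (B + 1), (Nat.le_div_iff_mul_le (Nat.succ_pos B)).2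
      (by rw [mul_comm]; exact hn), (Nat.mod_lt _ (Nat.succ_pos B)).le, Nat.div_add_mod _ _⟩
  obtain ⟨M, hM, c, hc⟩ := hm₀ m ((le_max_left _ _).trans hm)
  have hM0 : 0 < M := by
    have := (Real.exp_pos _).trans_le hM
    exact_mod_cast this
  obtain ⟨c', hc'⟩ := exists_code_of_blockCode c ch hM0 hc B
  obtain ⟨c'', hc''⟩ := ch.exists_code_add c' r
  refine ⟨M ^ B, c'', ?_, ?_⟩
  · push_cast
    refine le_trans ?_ (pow_le_pow_left₀ (Real.exp_pos _).le hM B)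
    rw [← Real.exp_nat_mul, Real.exp_le_exp]
    have h1 : (m₁ : ℝ) ≤ m := by exact_mod_cast (le_max_right m₀ m₁).trans hm
    have h2 : (r : ℝ) ≤ B + 1 := by exact_mod_cast hr
    have h3 : (m₁ : ℝ) * (B * R' - (B + 1) * R) ≤ m * (B * R' - (B + 1) * R) :=
      mul_le_mul_of_nonneg_right h1 (by linarith)
    have h4 : (r : ℝ) * R ≤ (B + 1) * R := mul_le_mul_of_nonneg_right h2 h0.le
    linarith
  · rw [hc'']
    refine hc'.trans (le_of_eq ?_)
    field_simp

/-- Achievability strictly below the rate suffices, since a real number lies strictly between any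
two distinct extended reals. -/
theorem Input.rate_le_capacity [Nonempty X₁] [Nonempty X₂] :
    (P.rate ch : EReal) ≤ ch.capacity := by
  by_contra! h
  obtain ⟨R, hR, hRP⟩ := EReal.lt_iff_exists_real_btwn.1 h
  exact hR.not_ge (le_iSup₂_of_le R (P.achievable_of_lt_rate ch (EReal.coe_lt_coe_iff.1 hRP)) le_rfl)

end Achievability

/-! ### Existence of the maximum -/

section Maximum

variable {X₁ X₂ S Y₂ Y₃ : Type*} [Fintype X₁] [Fintype X₂] [Fintype S] [Fintype Y₂] [Fintype Y₃]

variable {Ω α β γ : Type*} [Fintype Ω] [Fintype α] [Fintype β] [Fintype γ]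

theorem continuous_entropy (A : Ω → α) : Continuous fun p : Ω → ℝ => entropy p A := by
  unfold entropy
  refine continuous_finsetSum _ fun a _ => Real.continuous_negMulLog.comp ?_
  simp only [law_eq_sum_ind]
  fun_prop

theorem continuous_condEntropy (A : Ω → α) (B : Ω → β) :
    Continuous fun p : Ω → ℝ => condEntropy p A B :=
  (continuous_entropy _).sub (continuous_entropy _)

theorem continuous_mutualInfo (A : Ω → α) (B : Ω → β) :
    Continuous fun p : Ω → ℝ => mutualInfo p A B :=
  (continuous_entropy _).sub (continuous_condEntropy _ _)

theorem continuous_condMutualInfo (A : Ω → α) (B : Ω → β) (C : Ω → γ) :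
    Continuous fun p : Ω → ℝ => condMutualInfo p A B C :=
  (continuous_condEntropy _ _).sub (continuous_condEntropy _ _)

/-- The continuous image of a product of simplices: the joint law is polynomial in the tables of the
factors, and entropy is continuous also at zero probabilities. -/
theorem isCompact_setOf_rate (U₁ U₂ : Type*) [Fintype U₁] [Fintype U₂]
    (ch : Channel X₁ X₂ S Y₂ Y₃) :
    IsCompact {r | ∃ P : Input X₁ X₂ S U₁ U₂, P.rate ch = r} := by
  let K : Set ((U₁ → ℝ) × (U₁ → X₁ → ℝ) × (U₁ → S → U₂ → ℝ) × (U₁ → U₂ → S → X₂ → ℝ)) :=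
    stdSimplex ℝ U₁ ×ˢ (Set.univ.pi fun _ => stdSimplex ℝ X₁) ×ˢ
      (Set.univ.pi fun _ => Set.univ.pi fun _ => stdSimplex ℝ U₂) ×ˢ
      (Set.univ.pi fun _ => Set.univ.pi fun _ => Set.univ.pi fun _ => stdSimplex ℝ X₂)
  have hK : IsCompact K := (isCompact_stdSimplex ℝ U₁).prod
    ((isCompact_univ_pi fun _ => isCompact_stdSimplex ℝ X₁).prod
      ((isCompact_univ_pi fun _ => isCompact_univ_pi fun _ => isCompact_stdSimplex ℝ U₂).prod
        (isCompact_univ_pi fun _ => isCompact_univ_pi fun _ => isCompact_univ_pi fun _ =>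
          isCompact_stdSimplex ℝ X₂)))
  let J : (U₁ → ℝ) × (U₁ → X₁ → ℝ) × (U₁ → S → U₂ → ℝ) × (U₁ → U₂ → S → X₂ → ℝ) →
      S × U₁ × U₂ × X₁ × X₂ × Y₂ × Y₃ → ℝ := fun d z =>
    ch.Q z.1 * d.1 z.2.1 * d.2.1 z.2.1 z.2.2.2.1 * d.2.2.1 z.2.1 z.1 z.2.2.1 *
      d.2.2.2 z.2.1 z.2.2.1 z.1 z.2.2.2.2.1 *
      ch.W z.2.2.2.1 z.2.2.2.2.1 z.1 (z.2.2.2.2.2.1, z.2.2.2.2.2.2)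
  have hJ : Continuous J := by
    refine continuous_pi fun z => ?_
    fun_prop
  have hrate := (((continuous_condMutualInfo (fun ((_, _, _, x₁, _, _, _) :
        S × U₁ × U₂ × X₁ × X₂ × Y₂ × Y₃) => x₁)
      (fun (_, _, _, _, _, y₂, _) => y₂) (fun (s, u₁, _, _, _, _, _) => (s, u₁))).min
    ((continuous_mutualInfo (fun ((_, u₁, u₂, x₁, _, _, _) :
        S × U₁ × U₂ × X₁ × X₂ × Y₂ × Y₃) => (x₁, u₁, u₂))
        (fun (_, _, _, _, _, _, y₃) => y₃)).sub
      (continuous_condMutualInfo (fun ((_, _, u₂, _, _, _, _) :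
        S × U₁ × U₂ × X₁ × X₂ × Y₂ × Y₃) => u₂)
        (fun (s, _, _, _, _, _, _) => s) (fun (_, u₁, _, _, _, _, _) => u₁)))).comp hJ)
  convert hK.image hrate using 1
  ext r
  constructor
  · rintro ⟨P, rfl⟩
    exact ⟨(P.PU₁, P.PX₁, P.PU₂, P.PX₂), ⟨P.PU₁_mem, fun u₁ _ => P.PX₁_mem u₁,
      fun u₁ _ s _ => P.PU₂_mem u₁ s, fun u₁ _ u₂ _ s _ => P.PX₂_mem u₁ u₂ s⟩, rfl⟩
  · rintro ⟨⟨a, b, c, d⟩, ⟨ha, hb, hc, hd⟩, rfl⟩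
    exact ⟨⟨a, ha, b, fun u₁ => hb u₁ trivial, c, fun u₁ s => hc u₁ trivial s trivial, d,
      fun u₁ u₂ s => hd u₁ trivial u₂ trivial s trivial⟩, rfl⟩

theorem Channel.isCompact_innerRates (ch : Channel X₁ X₂ S Y₂ Y₃) : IsCompact ch.innerRates := by
  have h : ch.innerRates = ⋃ k₁ ∈ Set.Iic (Fintype.card S * Fintype.card X₁ * Fintype.card X₂ + 1),
      ⋃ k₂ ∈ Set.Iic ((Fintype.card S * Fintype.card X₁ * Fintype.card X₂ + 1) *
        (Fintype.card S * Fintype.card X₁ * Fintype.card X₂)),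
      {r | ∃ P : Input X₁ X₂ S (Fin k₁) (Fin k₂), P.rate ch = r} := by
    ext r
    simp only [Channel.innerRates, Set.mem_ofPred_eq, Set.mem_iUnion, Set.mem_Iic, exists_prop]
    constructor
    · rintro ⟨k₁, k₂, h₁, h₂, h⟩
      exact ⟨k₁, h₁, k₂, h₂, h⟩
    · rintro ⟨k₁, h₁, k₂, h₂, h⟩
      exact ⟨k₁, k₂, h₁, h₂, h⟩
  rw [h]
  exact (Set.finite_Iic _).isCompact_biUnion fun k₁ _ =>
    (Set.finite_Iic _).isCompact_biUnion fun k₂ _ => isCompact_setOf_rate _ _ ch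

theorem Channel.innerRates_nonempty [Nonempty X₁] [Nonempty X₂]
    (ch : Channel X₁ X₂ S Y₂ Y₃) : ch.innerRates.Nonempty := by
  classical
  have := ch.nonempty_state
  have hc : 0 < Fintype.card S * Fintype.card X₁ * Fintype.card X₂ :=
    Nat.mul_pos (Nat.mul_pos Fintype.card_pos Fintype.card_pos) Fintype.card_pos
  -- One-point auxiliary alphabets; the bound on the second size is at least one because `S`, `X₁`
  -- and `X₂` are nonempty.
  exact ⟨_, 1, 1, Nat.le_add_left 1 _, Nat.mul_pos (Nat.succ_pos _) hc,
    ⟨Pi.single 0 1, single_mem_stdSimplex ℝ 0,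
      fun _ => Pi.single (Classical.arbitrary X₁) 1, fun _ => single_mem_stdSimplex ℝ _,
      fun _ _ => Pi.single 0 1, fun _ _ => single_mem_stdSimplex ℝ 0,
      fun _ _ _ => Pi.single (Classical.arbitrary X₂) 1, fun _ _ _ => single_mem_stdSimplex ℝ _⟩,
    rfl⟩

end Maximum

end InformedRelay

theorem theorem1 {X₁ X₂ S Y₂ Y₃ : Type*} [Fintype X₁] [Fintype X₂] [Fintype S]
    [Fintype Y₂] [Fintype Y₃] [Nonempty X₁] [Nonempty X₂]
    (ch : InformedRelay.Channel X₁ X₂ S Y₂ Y₃) :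
    ∃ Rin : ℝ, IsGreatest ch.innerRates Rin ∧ (Rin : EReal) ≤ ch.capacity := by
  obtain ⟨r, hr⟩ := ch.isCompact_innerRates.exists_isGreatest ch.innerRates_nonempty
  refine ⟨r, hr, ?_⟩
  obtain ⟨k₁, k₂, -, -, P, rfl⟩ := hr.1
  exact P.rate_le_capacity ch
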